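/- **Setting.** Identify a Dirichlet series $\sum_{n\ge1}f(n)n^{-s}$ with the sequence $f:\mathbf N\to\mathbf C$, where $\mathbf N=\{1,2,\dots\}$. Column-finite complex matrices $A=(a_{m,n})_{m,n\in\mathbf N}$ act on such series from the right by $(fA)(n)=\sum_m a_{m,n}f(m)$. Let $S=\begin{pmatrix}0&-1\\1&0\end{pmatrix}$, $T=\begin{pmatrix}1&1\\0&1\end{pmatrix}$. The representation $\rho$ of $\mathrm{SL}(2,\mathbf Z)$ by invertible column-finite matrices is constructed as follows. * Let $b_0=b_1=1$ and $b_n=-\sum_{i+j=n,\ i,j\ge1}b_ib_j$ for $n\ge2$. Put $B_0=T$, $B_1=\begin{pmatrix}0&1\\1&1\end{pmatrix}$, $B_n=\begin{pmatrix}0&b_n\\b_n&0\end{pmatrix}$ for $n\ge2$. Let $\tilde J$ be the block upper triangular matrix whose $(r,c)$ block is $B_{c-r}$ for $r\le c$, and let $\tilde S=\mathrm{diag}(S,S,\dots)$. There is a unique representation $\tau_1$ of $\mathrm{SL}(2,\mathbf Z)$ with $\tau_1(S)=\tilde S$, $\tau_1(T)=\tilde J$. * Let $P$ be the (upper unitriangular)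 matrix whose $n$-th row is the first row of $(\tilde J-I)^{n-1}$. * Let $D$ be the divisor matrix ($d_{i,j}=1$ if $i\mid j$, and $0$ otherwise) and let $Z$ be the (upper unitriangular) matrix whose row $2^kd$, for $d$ odd and $k\ge 0$, is row $d$ of $(D-I)^k$. * For a column-finite matrix $A$ let $\psi(A)$ be the matrix with $\psi(A)_{2^{k-1}d,\,2^{\ell-1}d}=A_{k,\ell}$ for all odd $d$ and all $k,\ell\in\mathbf N$, and all other entries $0$. * $\rho(Y)=Z^{-1}\,\psi\bigl(P\,\tau_1(Y)\,P^{-1}\bigr)\,Z$ for $Y\in\mathrm{SL}(2,\mathbf Z)$. Write $1$ for the Dirichlet series with the single term $1^{-s}$, put $\varphi=1.\rho(-S)$, and let $\sigma_c$ be the abscissa of (conditional) convergence of $\varphi(s)$. **Theorem.** The Dirichlet series $1$, $\zeta(s)=\sum_n n^{-s}$ and $\varphi(s)$ lie in one and the same $\mathrm{SL}(2,\mathbf Z)$-orbit under $\rho$. The abscissa $\sigma_c$ is not $+\infty$, and every Dirichlet series in this common orbit converges for $\mathrm{Re}(s)>\max(1,\sigma_c)$ and defines an analytic function there. In the field of meromorphic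 functions on this half-plane, each of these functions belongs to the subfield $\mathbf C(\zeta(s),\varphi(s))$, and more precisely to the additive subgroup generated by the elements $\zeta(s)^m$ and $\varphi(s)\zeta(s)^m$, $m\in\mathbf Z$. -/

import Mathlib

noncomputable section

namespace DivisorSL2

section Representation

open PowerSeries Matrix MatrixGroups

/-! ### Homomorphisms out of `SL(2, ℤ)` -/

/-- The relations `s ^ 4 = 1`, `(s t) ^ 3 = s ^ 2` (with `s ^ 2` central) define `SL(2, ℤ)`. -/
theorem exists_hom_SL2Z {A : Type*} [Group A] (s t : A) (hs : s ^ 4 = 1)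
    (hst : (s * t) ^ 3 = s ^ 2) (hc : t * s ^ 2 = s ^ 2 * t) :
    ∃ f : SL(2, ℤ) →* A, f ModularGroup.S = s ∧ f ModularGroup.T = t := by
  obtain ⟨σ, hσ⟩ : ∃ σ : SL(2, ℤ) × A, σ = (ModularGroup.S, s) := ⟨_, rfl⟩
  obtain ⟨τ, hτ⟩ : ∃ τ : SL(2, ℤ) × A, τ = (ModularGroup.T, t) := ⟨_, rfl⟩
  have h4 : σ ^ 4 = 1 := by
    subst hσ; exact Prod.ext (show ModularGroup.S ^ 4 = 1 by decide) hs
  have hcc : τ * σ ^ 2 = σ ^ 2 * τ := by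
    subst hσ hτ; exact Prod.ext (show ModularGroup.T * ModularGroup.S ^ 2 = ModularGroup.S ^ 2 * ModularGroup.T by decide) hc
  have h6 : (σ * τ) ^ 3 = σ ^ 2 := by
    subst hσ hτ; exact Prod.ext (show (ModularGroup.S * ModularGroup.T) ^ 3 = ModularGroup.S ^ 2 by decide) hst
  have h5 : τ * σ * τ * σ * τ = σ := by
    have : σ * (τ * σ * τ * σ * τ) = σ * σ := by
      rw [← pow_two, ← h6]; simp only [pow_succ, pow_zero, one_mul, mul_assoc]
    exact mul_left_cancel this
  have hτi : τ⁻¹ = σ * τ * σ * τ * σ * σ * σ := by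
    rw [_root_.inv_eq_iff_mul_eq_one]
    have : τ * (σ * τ * σ * τ * σ * σ * σ) = (τ * σ * τ * σ * τ) * σ ^ 3 := by
      simp only [pow_succ, pow_zero, one_mul, mul_assoc]
    rw [this, h5, ← pow_succ', h4]
  have hσi : σ⁻¹ = σ * σ * σ := by
    rw [_root_.inv_eq_iff_mul_eq_one, ← h4]; simp only [pow_succ, pow_zero, one_mul, mul_assoc]
  let M : Submonoid (SL(2, ℤ) × A) := Submonoid.closure {τ, τ * σ * τ}
  have hMτ : τ ∈ M := Submonoid.subset_closure (by simp)
  have hMl : τ * σ * τ ∈ M := Submonoid.subset_closure (by simp)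
  let N : Set (SL(2, ℤ) × A) := {x | ∃ i j : ℕ, ∃ w ∈ M, x = σ ^ i * w * σ ^ j}
  have hNσ : ∀ x ∈ N, σ * x ∈ N := by
    rintro x ⟨i, j, w, hw, rfl⟩
    exact ⟨i + 1, j, w, hw, by simp only [pow_succ', mul_assoc]⟩
  have hNτ0 : ∀ w ∈ M, ∀ j : ℕ, τ * σ * w * σ ^ j ∈ N := by
    intro w hw j
    induction hw using Submonoid.closure_induction_left with
    | one => exact ⟨0, j + 1, τ, hMτ, by simp [pow_succ', mul_assoc]⟩
    | mul_left x hx y hy ih =>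
      rcases hx with rfl | hx
      · exact ⟨0, j, x * σ * x * y, M.mul_mem hMl hy, by simp [mul_assoc]⟩
      · rw [Set.mem_singleton_iff] at hx
        refine ⟨1, j, y, hy, ?_⟩
        have : τ * σ * (x * y) * σ ^ j = (τ * σ * τ * σ * τ) * y * σ ^ j := by
          rw [hx]; simp only [mul_assoc]
        rw [this, h5, pow_one]
  have hcp : ∀ k : ℕ, τ * σ ^ (2 * k) = σ ^ (2 * k) * τ := by
    intro k; rw [pow_mul]; exact (Commute.pow_right (show Commute τ (σ ^ 2) from hcc) k)
  have hNpow : ∀ (i : ℕ), ∀ x ∈ N, σ ^ i * x ∈ N := by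
    intro i; induction i with
    | zero => intro x hx; simpa using hx
    | succ i ih => intro x hx; rw [pow_succ', mul_assoc]; exact hNσ _ (ih x hx)
  have hNτ : ∀ x ∈ N, τ * x ∈ N := by
    rintro x ⟨i, j, w, hw, rfl⟩
    rcases Nat.even_or_odd' i with ⟨k, rfl | rfl⟩
    · refine ⟨2 * k, j, τ * w, M.mul_mem hMτ hw, ?_⟩
      simp only [← mul_assoc, hcp]
    · have := hNpow (2 * k) _ (hNτ0 w hw j)
      convert this using 1
      simp only [pow_succ, ← mul_assoc, hcp]
  let H : Subgroup (SL(2, ℤ) × A) := Subgroup.closure {σ, τ}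
  have hHN : ∀ x ∈ H, x ∈ N := by
    intro x hx
    induction hx using Subgroup.closure_induction_left with
    | one => exact ⟨0, 0, 1, M.one_mem, by simp⟩
    | mul_left x hx y hy ih =>
      rcases hx with rfl | rfl
      · exact hNσ _ ih
      · exact hNτ _ ih
    | inv_mul_cancel x hx y hy ih =>
      rcases hx with rfl | rfl
      · rw [hσi]; simp only [mul_assoc]; exact hNσ _ (hNσ _ (hNσ _ ih))
      · rw [hτi]; simp only [mul_assoc]
        exact hNσ _ (hNτ _ (hNσ _ (hNτ _ (hNσ _ (hNσ _ (hNσ _ ih))))))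
  have hMpos : ∀ w ∈ M, w = 1 ∨ ((∀ i j, 0 ≤ w.1 i j) ∧
      3 ≤ w.1 0 0 + w.1 0 1 + w.1 1 0 + w.1 1 1 ∧ 0 < w.1 0 0 + w.1 0 1 ∧
      0 < w.1 1 0 + w.1 1 1) := by
    intro w hw
    induction hw using Submonoid.closure_induction_left with
    | one => exact Or.inl rfl
    | mul_left x hx y hy ih =>
      right
      rcases hx with hx | hx
      · rw [hx, hτ]
        rcases ih with rfl | ⟨h0, h3, ha, hb⟩
        · simp [Fin.forall_fin_two]
        · have := h0 0 0; have := h0 0 1; have := h0 1 0; have := h0 1 1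
          simp [Matrix.SpecialLinearGroup.coe_mul, Fin.forall_fin_two, Matrix.mul_apply, Fin.sum_univ_two]
          refine ⟨⟨⟨?_, ?_⟩, ?_, ?_⟩, ?_, ?_, ?_⟩ <;> linarith
      · rw [Set.mem_singleton_iff.1 hx, hτ, hσ]
        rcases ih with rfl | ⟨h0, h3, ha, hb⟩
        · simp [Matrix.SpecialLinearGroup.coe_mul, Fin.forall_fin_two]
        · have := h0 0 0; have := h0 0 1; have := h0 1 0; have := h0 1 1
          simp [Matrix.SpecialLinearGroup.coe_mul, Fin.forall_fin_two, Matrix.mul_apply,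
            Fin.sum_univ_two]
          refine ⟨⟨⟨?_, ?_⟩, ?_, ?_⟩, ?_, ?_, ?_⟩ <;> linarith
  have hS4 : (ModularGroup.S) ^ 4 = 1 := by simpa [hσ] using congrArg Prod.fst h4
  have hSsum : ∀ n : ℕ, n % 4 = 0 ∨ (ModularGroup.S ^ n ≠ 1) := by
    intro n
    by_contra! h
    rw [← Nat.div_add_mod n 4, pow_add, pow_mul, hS4, one_pow, one_mul] at h
    have h2 := h.2
    have hlt := Nat.mod_lt n (show 4 > 0 by norm_num)
    have h1 := h.1
    simp only [Nat.mul_add_mod, Nat.mod_mod] at h1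
    generalize n % 4 = m at h1 h2 hlt
    interval_cases m
    · exact h1 rfl
    all_goals revert h2; decide
  have hSle : ∀ n : ℕ, (ModularGroup.S ^ n) 0 0 + (ModularGroup.S ^ n) 0 1 +
      (ModularGroup.S ^ n) 1 0 + (ModularGroup.S ^ n) 1 1 ≤ 2 := by
    intro n
    rw [← Nat.div_add_mod n 4, pow_add, pow_mul, hS4, one_pow, one_mul]
    have hlt := Nat.mod_lt n (show 4 > 0 by norm_num)
    generalize n % 4 = m at hlt
    interval_cases m <;> decide
  have hker : ∀ x ∈ H, x.1 = 1 → x = 1 := by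
    intro x hx h1
    obtain ⟨i, j, w, hw, rfl⟩ := hHN x hx
    have hw1 : w = 1 := by
      rcases hMpos w hw with h | ⟨-, h3, -⟩
      · exact h
      · exfalso
        have e1 : ModularGroup.S ^ i * w.1 * ModularGroup.S ^ j = 1 := by simpa [hσ] using h1
        have e2 : w.1 = ModularGroup.S ^ (3 * i + 3 * j) := by
          have hi : ∀ k : ℕ, ModularGroup.S ^ (3 * k) * ModularGroup.S ^ k = 1 := fun k => by
            rw [← pow_add, show 3 * k + k = 4 * k by ring, pow_mul, hS4, one_pow]
          have hi' : ∀ k : ℕ, ModularGroup.S ^ k * ModularGroup.S ^ (3 * k) = 1 := fun k => by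
            rw [← pow_add, show k + 3 * k = 4 * k by ring, pow_mul, hS4, one_pow]
          calc w.1 = (ModularGroup.S ^ (3 * i) * ModularGroup.S ^ i) * w.1 *
                (ModularGroup.S ^ j * ModularGroup.S ^ (3 * j)) := by rw [hi, hi']; simp
            _ = ModularGroup.S ^ (3 * i) * (ModularGroup.S ^ i * w.1 * ModularGroup.S ^ j) *
                  ModularGroup.S ^ (3 * j) := by simp only [mul_assoc]
            _ = _ := by rw [e1, mul_one, pow_add]
        have := hSle (3 * i + 3 * j)
        rw [← e2] at this
        linarith
    subst hw1
    rw [mul_one, ← pow_add] at h1 ⊢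
    have h1' : ModularGroup.S ^ (i + j) = 1 := by simpa [hσ] using h1
    rcases hSsum (i + j) with h | h
    · rw [← Nat.div_add_mod (i + j) 4, h, add_zero, pow_mul, h4, one_pow]
    · exact absurd h1' h
  let π : H →* SL(2, ℤ) := (MonoidHom.fst _ _).comp H.subtype
  have hπ : Function.Bijective π := by
    constructor
    · rw [injective_iff_map_eq_one]
      rintro ⟨x, hx⟩ h
      exact Subtype.ext (hker x hx h)
    · rw [← MonoidHom.range_eq_top, MonoidHom.range_comp, Subgroup.range_subtype,
        MonoidHom.map_closure]
      rw [← SpecialLinearGroup.SL2Z_generators, Set.image_pair, hσ, hτ]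
      rfl
  let e := MulEquiv.ofBijective π hπ
  have hσH : σ ∈ H := Subgroup.subset_closure (by simp)
  have hτH : τ ∈ H := Subgroup.subset_closure (by simp)
  have eσ : e.symm ModularGroup.S = ⟨σ, hσH⟩ := by
    rw [MulEquiv.symm_apply_eq]; change _ = σ.1; rw [hσ]
  have eτ : e.symm ModularGroup.T = ⟨τ, hτH⟩ := by
    rw [MulEquiv.symm_apply_eq]; change _ = τ.1; rw [hτ]
  refine ⟨((MonoidHom.snd _ _).comp H.subtype).comp e.symm.toMonoidHom, ?_, ?_⟩
  · change ((e.symm ModularGroup.S : H) : SL(2, ℤ) × A).2 = s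
    rw [eσ]; exact congrArg Prod.snd hσ
  · change ((e.symm ModularGroup.T : H) : SL(2, ℤ) × A).2 = t
    rw [eτ]; exact congrArg Prod.snd hτ

/-! ### Column-finite matrices -/

/-- The space of columns indexed by `ι` with finitely many nonzero entries. Its endomorphisms are
the column-finite matrices. Dirichlet series use `ι = ℕ+`; the auxiliary matrices of the
construction are indexed by `ι = ℕ`, starting at `0` instead of `1`. -/
abbrev Col (ι : Type) := ι →₀ ℂ

/-- The column-finite matrix with given columns. -/
def ofCols {ι : Type} (c : ι → Col ι) : Module.End ℂ (Col ι) := Finsupp.linearCombination ℂ c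

/-- The `(i, j)` entry of a column-finite matrix. -/
def entry {ι : Type} (A : Module.End ℂ (Col ι)) (i j : ι) : ℂ := A (Finsupp.single j 1) i

@[simp] lemma ofCols_single {ι : Type} (c : ι → Col ι) (j : ι) (a : ℂ) :
    ofCols c (Finsupp.single j a) = a • c j := by simp [ofCols]

/-- Column `2 c + b` of the block upper triangular Toeplitz matrix attached to `X`. -/
def toeplitzCol (X : Matrix (Fin 2) (Fin 2) ℂ⟦X⟧) (c : ℕ) (b : Fin 2) : Col ℕ :=
  ∑ p ∈ Finset.HasAntidiagonal.antidiagonal c, ∑ a : Fin 2,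
    Finsupp.single (2 * p.1 + (a : ℕ)) (coeff p.2 (X a b))

/-- The block upper triangular matrix with `2 × 2` blocks whose block in position `(r, c)`, `r ≤ c`,
is the coefficient of `t ^ (c - r)` in `X`. -/
def toeplitzFun (X : Matrix (Fin 2) (Fin 2) ℂ⟦X⟧) : Module.End ℂ (Col ℕ) :=
  ofCols fun j => toeplitzCol X (j / 2) (Fin.ofNat 2 j)

lemma toeplitzFun_single (X : Matrix (Fin 2) (Fin 2) ℂ⟦X⟧) (c : ℕ) (b : Fin 2) (z : ℂ) :
    toeplitzFun X (Finsupp.single (2 * c + (b : ℕ)) z) = z • toeplitzCol X c b := by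
  have h1 : (2 * c + (b : ℕ)) / 2 = c := by omega
  have h2 : Fin.ofNat 2 (2 * c + (b : ℕ)) = b := by
    apply Fin.ext; simp [Fin.ofNat]; omega
  rw [toeplitzFun, ofCols_single, h1, h2]

lemma end_ext {f g : Module.End ℂ (Col ℕ)}
    (h : ∀ (c : ℕ) (b : Fin 2), f (Finsupp.single (2 * c + (b : ℕ)) 1) =
      g (Finsupp.single (2 * c + (b : ℕ)) 1)) : f = g := by
  ext1 j
  ext1
  have := h (j / 2) ⟨j % 2, Nat.mod_lt _ two_pos⟩
  simpa [Nat.div_add_mod] using this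

lemma sum_antidiagonal_assoc {M : Type*} [AddCommMonoid M] (F : ℕ → ℕ → ℕ → M) (n : ℕ) :
    ∑ p ∈ Finset.HasAntidiagonal.antidiagonal n, ∑ q ∈ Finset.HasAntidiagonal.antidiagonal p.2,
      F p.1 q.1 q.2 =
    ∑ p ∈ Finset.HasAntidiagonal.antidiagonal n, ∑ q ∈ Finset.HasAntidiagonal.antidiagonal p.1,
      F q.1 q.2 p.2 := by
  rw [Finset.sum_sigma', Finset.sum_sigma']
  refine Finset.sum_nbij' (fun x : (_ : ℕ × ℕ) × ℕ × ℕ => ⟨(x.1.1 + x.2.1, x.2.2), (x.1.1, x.2.1)⟩)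
    (fun x : (_ : ℕ × ℕ) × ℕ × ℕ => ⟨(x.2.1, x.2.2 + x.1.2), (x.2.2, x.1.2)⟩) ?_ ?_ ?_ ?_ ?_
  · rintro ⟨⟨a, b⟩, ⟨d, e⟩⟩ h; simp at h ⊢; omega
  · rintro ⟨⟨a, b⟩, ⟨d, e⟩⟩ h; simp at h ⊢; omega
  · rintro ⟨⟨a, b⟩, ⟨d, e⟩⟩ h; simp at h ⊢; exact h.2
  · rintro ⟨⟨a, b⟩, ⟨d, e⟩⟩ h; simp at h ⊢; exact h.2
  · rintro ⟨⟨a, b⟩, ⟨d, e⟩⟩ h; rfl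

/-- `toeplitzFun` is a ring homomorphism (the inverse of the isomorphism `γ`). -/
def toeplitz : Matrix (Fin 2) (Fin 2) ℂ⟦X⟧ →+* Module.End ℂ (Col ℕ) where
  toFun := toeplitzFun
  map_one' := by
    apply end_ext
    intro c b
    rw [toeplitzFun_single, one_smul, toeplitzCol, Finset.sum_eq_single (c, 0)]
    · rw [Finset.sum_eq_single b] <;> simp +contextual
    · rintro ⟨p, q⟩ hp hne
      have hq : q ≠ 0 := by
        rintro rfl; apply hne; simpa using hp
      apply Finset.sum_eq_zero
      intro a _
      simp [Matrix.one_apply, apply_ite, PowerSeries.coeff_one, hq]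
    · simp
  map_zero' := by
    apply end_ext; intro c b
    rw [toeplitzFun_single]; simp [toeplitzCol]
  map_add' X Y := by
    apply end_ext; intro c b
    simp [toeplitzFun_single, toeplitzCol, Finset.sum_add_distrib]
  map_mul' X Y := by
    apply end_ext; intro c b
    rw [Module.End.mul_apply, toeplitzFun_single, toeplitzFun_single, one_smul, one_smul]
    have hY : toeplitzFun X (toeplitzCol Y c b) = ∑ p ∈ Finset.HasAntidiagonal.antidiagonal c, ∑ d : Fin 2,
        coeff p.2 (Y d b) • toeplitzCol X p.1 d := by
      simp only [toeplitzCol, map_sum, toeplitzFun_single]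
    rw [hY]
    have hL : toeplitzCol (X * Y) c b = ∑ p ∈ Finset.HasAntidiagonal.antidiagonal c,
        ∑ q ∈ Finset.HasAntidiagonal.antidiagonal p.2, ∑ a : Fin 2, ∑ d : Fin 2,
          Finsupp.single (2 * p.1 + (a : ℕ)) (coeff q.1 (X a d) * coeff q.2 (Y d b)) := by
      simp only [toeplitzCol, Matrix.mul_apply, map_sum, PowerSeries.coeff_mul,
        Finsupp.single_finsetSum]
      refine Finset.sum_congr rfl fun p _ => ?_
      rw [Finset.sum_comm]
      conv_rhs => rw [Finset.sum_comm]
      rw [Finset.sum_comm]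
      exact Finset.sum_congr rfl fun a _ => Finset.sum_comm
    have hR : (∑ p ∈ Finset.HasAntidiagonal.antidiagonal c, ∑ d : Fin 2,
        coeff p.2 (Y d b) • toeplitzCol X p.1 d) = ∑ p ∈ Finset.HasAntidiagonal.antidiagonal c,
        ∑ q ∈ Finset.HasAntidiagonal.antidiagonal p.1, ∑ a : Fin 2, ∑ d : Fin 2,
          Finsupp.single (2 * q.1 + (a : ℕ)) (coeff q.2 (X a d) * coeff p.2 (Y d b)) := by
      simp only [toeplitzCol, Finset.smul_sum, Finsupp.smul_single, smul_eq_mul]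
      refine Finset.sum_congr rfl fun p _ => ?_
      rw [Finset.sum_comm]
      refine Finset.sum_congr rfl fun q _ => ?_
      rw [Finset.sum_comm]
      simp only [mul_comm]
    rw [hL, hR]
    exact sum_antidiagonal_assoc (fun i j k => ∑ a : Fin 2, ∑ d : Fin 2,
      Finsupp.single (2 * i + (a : ℕ)) (coeff j (X a d) * coeff k (Y d b))) c

/-- `b_0 = b_1 = 1` and `b_n + ∑_{i + j = n, i, j ≥ 1} b_i b_j = 0` for `n ≥ 2`. -/
def bSeq : ℕ → ℤ
  | 0 => 1
  | 1 => 1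
  | n + 2 => -∑ i : Fin (n + 1), bSeq (i + 1) * bSeq (n + 1 - i)

/-! ### The series `g(t)` and the representation `τ₁`. -/

/-- `1 + g(t) = ∑ b_k t ^ k`. -/
def gSeries : ℂ⟦X⟧ := PowerSeries.mk fun n => if n = 0 then 0 else (bSeq n : ℂ)

lemma gSeries_sq_add : gSeries ^ 2 + gSeries = X := by
  ext n
  rw [map_add, pow_two, PowerSeries.coeff_mul, PowerSeries.coeff_X]
  simp only [gSeries, PowerSeries.coeff_mk]
  match n with
  | 0 => simp
  | 1 => simp [Finset.Nat.antidiagonal_succ, bSeq]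
  | n + 2 =>
    rw [Finset.Nat.sum_antidiagonal_succ, Finset.Nat.sum_antidiagonal_succ']
    have h : bSeq (n + 2) = -∑ p ∈ Finset.HasAntidiagonal.antidiagonal n,
        bSeq (p.1 + 1) * bSeq (p.2 + 1) := by
      rw [bSeq, Finset.Nat.sum_antidiagonal_eq_sum_range_succ_mk, Finset.sum_range]
      refine congrArg _ (Finset.sum_congr rfl fun i _ => ?_)
      rw [show n + 1 - (i : ℕ) = n - i + 1 by omega]
    simp [h]

/-- The matrix of power series with coefficients `B 0, B 1, ...`. -/
def blockMatrix (B : ℕ → Matrix (Fin 2) (Fin 2) ℂ) : Matrix (Fin 2) (Fin 2) ℂ⟦X⟧ :=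
  Matrix.of fun i j => PowerSeries.mk fun n => B n i j

/-- The blocks `B_0 = T`, `B_1`, and `B_n`. -/
def jBlock : ℕ → Matrix (Fin 2) (Fin 2) ℂ
  | 0 => !![1, 1; 0, 1]
  | 1 => !![0, 1; 1, 1]
  | n + 2 => !![0, (bSeq (n + 2) : ℂ); (bSeq (n + 2) : ℂ), 0]

/-- The blocks of `diag(S, S, ...)`. -/
def sBlock : ℕ → Matrix (Fin 2) (Fin 2) ℂ
  | 0 => !![0, -1; 1, 0]
  | _ + 1 => 0

lemma blockMatrix_jBlock : blockMatrix jBlock = !![1, 1 + gSeries; gSeries, 1 + X] := by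
  ext i j n
  match n with
  | 0 => fin_cases i <;> fin_cases j <;> simp [blockMatrix, jBlock, gSeries]
  | 1 => fin_cases i <;> fin_cases j <;>
      simp [blockMatrix, jBlock, gSeries, bSeq, PowerSeries.coeff_one, PowerSeries.coeff_X]
  | n + 2 => fin_cases i <;> fin_cases j <;>
      simp [blockMatrix, jBlock, gSeries, PowerSeries.coeff_one, PowerSeries.coeff_X]

lemma blockMatrix_sBlock : blockMatrix sBlock = !![0, -1; 1, 0] := by
  ext i j n
  match n with
  | 0 => fin_cases i <;> fin_cases j <;> simp [blockMatrix, sBlock]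
  | n + 1 => fin_cases i <;> fin_cases j <;>
      simp [blockMatrix, sBlock, PowerSeries.coeff_one]

/-- The matrix `J̃`, with block `B_{c - r}` in position `(r, c)`. -/
def Jt : Module.End ℂ (Col ℕ) := toeplitz (blockMatrix jBlock)
/-- The matrix `S̃ = diag(S, S, ...)`. -/
def St : Module.End ℂ (Col ℕ) := toeplitz (blockMatrix sBlock)

lemma St_sq : St * St + 1 = 0 := by
  rw [St, ← map_mul, blockMatrix_sBlock, ← map_one toeplitz, ← map_add, ← map_zero toeplitz]
  congr 1
  ext i j n; fin_cases i <;> fin_cases j <;> simp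

lemma St_Jt_cube : (St * Jt) ^ 3 + 1 = 0 := by
  have hg := gSeries_sq_add
  rw [St, Jt, ← map_mul, ← map_pow, blockMatrix_sBlock, blockMatrix_jBlock, ← map_one toeplitz,
    ← map_add, ← map_zero toeplitz]
  congr 1
  rw [pow_succ, pow_two, ← hg]
  ext1 i j
  fin_cases i <;> fin_cases j <;> simp <;> ring

lemma exists_hom_of_relations {R : Type*} [Ring R] (s t : R) (h2 : s * s + 1 = 0)
    (h3 : (s * t) ^ 3 + 1 = 0) :
    ∃ f : SL(2, ℤ) →* Rˣ, (f ModularGroup.S : R) = s ∧ (f ModularGroup.T : R) = t := by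
  have h2' : s * s = -1 := eq_neg_of_add_eq_zero_left h2
  have h3' : (s * t) ^ 3 = -1 := eq_neg_of_add_eq_zero_left h3
  let u : Rˣ := ⟨s, -s, by rw [mul_neg, h2', neg_neg], by rw [neg_mul, h2', neg_neg]⟩
  have h : IsUnit (s * t) := by
    have : IsUnit ((s * t) ^ 3) := by rw [h3']; exact isUnit_one.neg
    exact (isUnit_pow_iff (by norm_num)).1 this
  have ht : IsUnit t := by
    have e : t = (u⁻¹ : Rˣ) * (s * t) := by
      change t = -s * (s * t)
      rw [← mul_assoc, neg_mul, h2', neg_neg, one_mul]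
    rw [e]
    exact (u⁻¹).isUnit.mul h
  have hu : u ^ 2 = -1 := by
    ext1; rw [pow_two]; exact h2'
  obtain ⟨f, hf1, hf2⟩ := exists_hom_SL2Z u ht.unit
    (by rw [show 4 = 2 * 2 by rfl, pow_mul, hu]; simp)
    (by rw [hu]; ext1; exact h3') (by rw [hu]; simp)
  exact ⟨f, by rw [hf1], by rw [hf2]; rfl⟩

lemma exists_tau1 : ∃ f : SL(2, ℤ) →* (Module.End ℂ (Col ℕ))ˣ,
    (f ModularGroup.S : Module.End ℂ (Col ℕ)) = St ∧
    (f ModularGroup.T : Module.End ℂ (Col ℕ)) = Jt :=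
  exists_hom_of_relations St Jt St_sq St_Jt_cube

/-- The representation `τ₁` with `τ₁(S) = S̃` and `τ₁(T) = J̃`. -/
def tau1 : SL(2, ℤ) →* (Module.End ℂ (Col ℕ))ˣ := exists_tau1.choose

lemma tau1_S : (tau1 ModularGroup.S : Module.End ℂ (Col ℕ)) = St := exists_tau1.choose_spec.1
lemma tau1_T : (tau1 ModularGroup.T : Module.End ℂ (Col ℕ)) = Jt := exists_tau1.choose_spec.2

/-! ### Unitriangular matrices are invertible -/

lemma entry_mul {ι : Type} (A B : Module.End ℂ (Col ι)) (i j : ι) :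
    entry (A * B) i j = (B (Finsupp.single j 1)).sum fun k z => z * entry A i k := by
  have h : ∀ v : Col ι, (A v) i = v.sum fun k z => z * entry A i k := by
    intro v
    conv_lhs => rw [← Finsupp.sum_single v]
    rw [map_finsuppSum, Finsupp.sum_apply]
    refine Finsupp.sum_congr fun k _ => ?_
    rw [← mul_one (v k), ← smul_eq_mul, ← Finsupp.smul_single, map_smul]
    simp [entry]
  exact h _

lemma entry_add {ι : Type} (A B : Module.End ℂ (Col ι)) (i j : ι) :
    entry (A + B) i j = entry A i j + entry B i j := rfl

lemma entry_sub {ι : Type} (A B : Module.End ℂ (Col ι)) (i j : ι) :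
    entry (A - B) i j = entry A i j - entry B i j := rfl

lemma entry_one {ι : Type} [DecidableEq ι] (i j : ι) :
    entry (1 : Module.End ℂ (Col ι)) i j = if i = j then 1 else 0 := by
  simp [entry, Finsupp.single_apply, eq_comm]

lemma isUnit_of_unitriangular {ι : Type} [LinearOrder ι] [WellFoundedLT ι]
    (A : Module.End ℂ (Col ι)) (h1 : ∀ j, entry A j j = 1)
    (h0 : ∀ i j, j < i → entry A i j = 0) : IsUnit A := by
  rw [Module.End.isUnit_iff]
  constructor
  · rw [injective_iff_map_eq_zero]
    intro f hf
    by_contra hne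
    have hs : f.support.Nonempty := Finsupp.support_nonempty_iff.2 hne
    let m := f.support.max' hs
    have hm : m ∈ f.support := Finset.max'_mem _ _
    have : (A f) m = f m := by
      conv_lhs => rw [← Finsupp.sum_single f]
      rw [map_finsuppSum, Finsupp.sum_apply, Finsupp.sum, Finset.sum_eq_single m]
      · have := h1 m
        rw [← mul_one (f m), ← smul_eq_mul, ← Finsupp.smul_single, map_smul, Finsupp.smul_apply]
        simp only [entry] at this
        rw [this]
      · intro k hk hkm
        have hlt : k < m := lt_of_le_of_ne (Finset.le_max' _ _ hk) hkm
        have := h0 m k hlt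
        rw [← mul_one (f k), ← smul_eq_mul, ← Finsupp.smul_single, map_smul, Finsupp.smul_apply]
        simp only [entry] at this
        rw [this, smul_zero]
      · intro h; exact absurd hm h
    rw [hf] at this
    exact Finsupp.mem_support_iff.1 hm this.symm
  · have hj : ∀ j, Finsupp.single j (1 : ℂ) ∈ LinearMap.range A := by
      intro j
      induction j using WellFoundedLT.induction with
      | ind j ih =>
      have hd : A (Finsupp.single j 1) - Finsupp.single j 1 ∈ LinearMap.range A := by
        rw [← Finsupp.sum_single (A (Finsupp.single j 1) - Finsupp.single j 1)]
        refine Submodule.sum_mem _ fun i hi => ?_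
        have hij : i < j := by
          rw [Finsupp.mem_support_iff] at hi
          rcases lt_trichotomy i j with h | h | h
          · exact h
          · exfalso; apply hi; subst h
            have := h1 i
            simp only [entry] at this
            simp [this]
          · exfalso; apply hi
            have := h0 i j h
            simp only [entry] at this
            simp [this, h.ne]
        have := (LinearMap.range A).smul_mem
          ((A (Finsupp.single j 1) - Finsupp.single j 1 : Col ι) i) (ih i hij)
        rwa [Finsupp.smul_single, smul_eq_mul, mul_one] at this
      have := (LinearMap.range A).sub_mem (LinearMap.mem_range_self A (Finsupp.single j 1)) hd
      rwa [sub_sub_cancel] at this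
    rw [← LinearMap.range_eq_top, eq_top_iff]
    intro v _
    rw [← Finsupp.sum_single v]
    refine Submodule.sum_mem _ fun i _ => ?_
    have := (LinearMap.range A).smul_mem (v i) (hj i)
    rwa [Finsupp.smul_single, smul_eq_mul, mul_one] at this

/-! ### The matrix `P` bringing `J̃` to Jordan form -/

lemma toeplitzCol_apply (X : Matrix (Fin 2) (Fin 2) ℂ⟦X⟧) (c r : ℕ) (b a : Fin 2) :
    toeplitzCol X c b (2 * r + (a : ℕ)) = if r ≤ c then coeff (c - r) (X a b) else 0 := by
  rw [toeplitzCol, Finsupp.finsetSum_apply]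
  have key : ∀ p : ℕ × ℕ, (∑ a' : Fin 2, Finsupp.single (2 * p.1 + (a' : ℕ))
      (coeff p.2 (X a' b)) : Col ℕ) (2 * r + (a : ℕ)) =
      if p.1 = r then coeff p.2 (X a b) else 0 := by
    intro p
    have h : ∀ a' : Fin 2, (2 * p.1 + (a' : ℕ) = 2 * r + (a : ℕ)) ↔ (p.1 = r ∧ a' = a) := by
      intro a'
      have := a'.2; have := a.2
      rw [Fin.ext_iff]; omega
    rw [Finsupp.finsetSum_apply]
    simp only [Finsupp.single_apply, h]
    split_ifs with hp
    · simp [hp]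
    · simp [hp]
  simp only [key]
  split_ifs with hrc
  · rw [Finset.sum_eq_single (r, c - r)]
    · simp
    · rintro ⟨p, q⟩ hp hne
      rw [Finset.HasAntidiagonal.mem_antidiagonal] at hp
      simp only at hp ⊢
      rw [if_neg]
      rintro rfl
      apply hne; ext <;> simp; omega
    · intro h; exfalso; apply h
      rw [Finset.HasAntidiagonal.mem_antidiagonal]; simp [hrc]
  · apply Finset.sum_eq_zero
    rintro ⟨p, q⟩ hp
    rw [Finset.HasAntidiagonal.mem_antidiagonal] at hp
    simp only at hp ⊢
    rw [if_neg]; omega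

lemma entry_toeplitz (X : Matrix (Fin 2) (Fin 2) ℂ⟦X⟧) (r c : ℕ) (a b : Fin 2) :
    entry (toeplitz X) (2 * r + (a : ℕ)) (2 * c + (b : ℕ)) =
      if r ≤ c then coeff (c - r) (X a b) else 0 := by
  change toeplitzFun X (Finsupp.single (2 * c + (b : ℕ)) 1) _ = _
  rw [toeplitzFun_single, one_smul, toeplitzCol_apply]

lemma Jt_sub_one : Jt - 1 = toeplitz !![0, 1 + gSeries; gSeries, X] := by
  refine (sub_eq_iff_eq_add (G := Module.End ℂ (Col ℕ))).2 ?_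
  rw [Jt, blockMatrix_jBlock, ← map_one toeplitz, ← map_add]
  congr 1
  ext i j n; fin_cases i <;> fin_cases j <;> simp [add_comm]

lemma exists_fin_two (j : ℕ) : ∃ (c : ℕ) (b : Fin 2), j = 2 * c + (b : ℕ) :=
  ⟨j / 2, ⟨j % 2, Nat.mod_lt _ two_pos⟩, by simp [Nat.div_add_mod]⟩

lemma entry_Jt_sub_one_of_le {i j : ℕ} (h : j ≤ i) : entry (Jt - 1) i j = 0 := by
  obtain ⟨r, a, rfl⟩ := exists_fin_two i
  obtain ⟨c, b, rfl⟩ := exists_fin_two j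
  rw [Jt_sub_one, entry_toeplitz]
  split_ifs with hrc
  · obtain rfl : r = c := by have := a.2; omega
    rw [Nat.sub_self]
    fin_cases a <;> fin_cases b <;> simp [gSeries] at h ⊢
  · rfl

lemma entry_Jt_sub_one_succ (i : ℕ) : entry (Jt - 1) i (i + 1) = 1 := by
  obtain ⟨r, a, rfl⟩ := exists_fin_two i
  rw [Jt_sub_one]
  fin_cases a
  · rw [show 2 * r + ((⟨0, by norm_num⟩ : Fin 2) : ℕ) + 1 = 2 * r + ((1 : Fin 2) : ℕ) by simp,
      entry_toeplitz]
    simp [gSeries]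
  · rw [show 2 * r + ((⟨1, by norm_num⟩ : Fin 2) : ℕ) + 1 = 2 * (r + 1) + ((0 : Fin 2) : ℕ) by
      simp; ring, entry_toeplitz]
    simp [gSeries, bSeq]

lemma entry_pow_eq_zero (n : ℕ) : ∀ i j : ℕ, j < i + n → entry ((Jt - 1) ^ n) i j = 0 := by
  induction n with
  | zero =>
    intro i j h
    rw [pow_zero, entry_one, if_neg (by omega)]
  | succ n ih =>
    intro i j h
    rw [pow_succ, entry_mul]
    refine Finset.sum_eq_zero fun k hk => ?_
    have hkj : k < j := by
      by_contra hle
      exact Finsupp.mem_support_iff.1 hk (entry_Jt_sub_one_of_le (not_lt.1 hle))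
    simp only
    rw [ih i k (by omega), mul_zero]

lemma entry_pow_eq_one (n : ℕ) : ∀ i : ℕ, entry ((Jt - 1) ^ n) i (i + n) = 1 := by
  induction n with
  | zero => intro i; rw [pow_zero, entry_one, if_pos (by simp)]
  | succ n ih =>
    intro i
    rw [pow_succ, entry_mul, Finsupp.sum, Finset.sum_eq_single (i + n)]
    · rw [ih, mul_one]
      exact entry_Jt_sub_one_succ (i + n)
    · intro k hk hne
      have hkj : k < i + (n + 1) := by
        by_contra hle
        exact Finsupp.mem_support_iff.1 hk (entry_Jt_sub_one_of_le (not_lt.1 hle))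
      rw [entry_pow_eq_zero n i k (by omega), mul_zero]
    · intro h
      have := entry_Jt_sub_one_succ (i + n)
      rw [Finsupp.notMem_support_iff] at h
      change entry (Jt - 1) (i + n) (i + n + 1) = 0 at h
      rw [this] at h
      exact absurd h one_ne_zero

/-- The upper unitriangular matrix whose row `n` (counted from `0`) is the first row of
`(J̃ - 1) ^ n`; see `entry_P`. -/
def P : Module.End ℂ (Col ℕ) :=
  ofCols fun j => Finsupp.onFinset (Finset.range (j + 1)) (fun n => entry ((Jt - 1) ^ n) 0 j)
    fun n hn => by
      by_contra h
      rw [Finset.mem_range] at h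
      exact hn (entry_pow_eq_zero n 0 j (by omega))

lemma entry_P (n j : ℕ) : entry P n j = entry ((Jt - 1) ^ n) 0 j := by
  rw [entry, P, ofCols_single, one_smul, Finsupp.onFinset_apply]

lemma isUnit_P : IsUnit P :=
  isUnit_of_unitriangular P
    (fun j => by rw [entry_P]; simpa using entry_pow_eq_one j 0)
    (fun i j h => by rw [entry_P]; exact entry_pow_eq_zero i 0 j (by omega))

/-! ### The divisor matrix `D`, the matrix `Z`, and the representation `ρ` -/

/-- The divisor matrix; see `entry_D`. -/
def D : Module.End ℂ (Col ℕ+) :=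
  ofCols fun j => ∑ i ∈ (Finset.Icc 1 j).filter (fun i : ℕ+ => (i : ℕ) ∣ j), Finsupp.single i 1

lemma entry_D (i j : ℕ+) : entry D i j = if (i : ℕ) ∣ j then 1 else 0 := by
  rw [entry, D, ofCols_single, one_smul, Finsupp.finsetSum_apply]
  simp only [Finsupp.single_apply]
  rw [Finset.sum_ite_eq']
  simp only [Finset.mem_filter, Finset.mem_Icc, one_le, true_and]
  refine if_congr ⟨fun h => h.2, fun h => ⟨Nat.le_of_dvd j.pos h, h⟩⟩ rfl rfl

/-- The exponent of `2` in `n`. -/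
def val2 (n : ℕ+) : ℕ := (n : ℕ).factorization 2

/-- The odd number `d` with `n = 2 ^ k * d`. -/
def oddPart (n : ℕ+) : ℕ+ :=
  ⟨(n : ℕ) / 2 ^ (n : ℕ).factorization 2, Nat.ordCompl_pos 2 n.ne_zero⟩

lemma pow_mul_oddPart (n : ℕ+) : 2 ^ val2 n * oddPart n = n := by
  apply PNat.eq
  rw [PNat.mul_coe, PNat.pow_coe]
  exact Nat.ordProj_mul_ordCompl_eq_self (n : ℕ) 2

lemma oddPart_pow_mul (k : ℕ) (n : ℕ+) : oddPart (2 ^ k * oddPart n) = oddPart n := by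
  apply PNat.eq
  have h : ¬ 2 ∣ (n : ℕ) / 2 ^ (n : ℕ).factorization 2 :=
    Nat.not_dvd_ordCompl Nat.prime_two n.ne_zero
  change (((2 ^ k * oddPart n : ℕ+) : ℕ)) / 2 ^ (((2 ^ k * oddPart n : ℕ+) : ℕ)).factorization 2 = _
  rw [PNat.mul_coe, PNat.pow_coe]
  exact Nat.ordCompl_pow_mul_of_not_dvd k Nat.prime_two h

lemma val2_pow_mul (k : ℕ) (n : ℕ+) : val2 (2 ^ k * oddPart n) = k := by
  have h1 := pow_mul_oddPart (2 ^ k * oddPart n)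
  rw [oddPart_pow_mul] at h1
  have h2 := mul_right_cancel h1
  have h3 := congrArg (fun x : ℕ+ => (x : ℕ)) h2
  simp only [PNat.pow_coe] at h3
  exact Nat.pow_right_injective le_rfl h3

lemma entry_D_sub_one (i j : ℕ+) :
    entry (D - 1) i j = if (i : ℕ) ∣ j ∧ i ≠ j then 1 else 0 := by
  rw [entry_sub, entry_D, entry_one]
  by_cases h : i = j
  · simp [h]
  · simp [h]

lemma two_mul_le_of_entry {i j : ℕ+} (h : entry (D - 1) i j ≠ 0) : 2 * i ≤ j := by
  rw [entry_D_sub_one] at h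
  have h' : (i : ℕ) ∣ j ∧ i ≠ j := by by_contra hc; exact h (if_neg hc)
  obtain ⟨hd, hne⟩ := h'
  obtain ⟨c, rfl⟩ := PNat.dvd_iff.2 hd
  rw [mul_comm]
  refine mul_le_mul_right ?_ i
  have : c ≠ 1 := by rintro rfl; simp at hne
  have h1 : (1 : ℕ+) < c := lt_of_le_of_ne one_le (Ne.symm this)
  exact PNat.add_one_le_iff.2 h1

lemma le_of_entry_D_pow (k : ℕ) : ∀ d j : ℕ+, entry ((D - 1) ^ k) d j ≠ 0 → 2 ^ k * d ≤ j := by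
  induction k with
  | zero =>
    intro d j h
    rw [pow_zero, entry_one] at h
    have : d = j := by by_contra hc; exact h (if_neg hc)
    simp [this]
  | succ k ih =>
    intro d j h
    rw [pow_succ, entry_mul] at h
    obtain ⟨i, hi, hne⟩ := Finset.exists_ne_zero_of_sum_ne_zero h
    have h1 := two_mul_le_of_entry (i := i) (j := j) (Finsupp.mem_support_iff.1 hi)
    have h2 := ih d i (right_ne_zero_of_mul hne)
    calc 2 ^ (k + 1) * d = 2 * (2 ^ k * d) := by rw [pow_succ', mul_assoc]
      _ ≤ 2 * i := by gcongr
      _ ≤ j := h1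

lemma entry_D_pow_self (k : ℕ) (d : ℕ+) : entry ((D - 1) ^ k) d (2 ^ k * d) = 1 := by
  induction k with
  | zero => rw [pow_zero, entry_one]; simp
  | succ k ih =>
    have hone : entry (D - 1) (2 ^ k * d) (2 ^ (k + 1) * d) = 1 := by
      rw [entry_D_sub_one, if_pos]
      refine ⟨PNat.dvd_iff.1 ⟨2, by rw [pow_succ]; ring⟩, fun h => ?_⟩
      have h2 := congrArg (fun x : ℕ+ => (x : ℕ)) (mul_right_cancel h)
      simp only [PNat.pow_coe] at h2
      have := Nat.pow_right_injective le_rfl h2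
      omega
    rw [pow_succ, entry_mul, Finsupp.sum, Finset.sum_eq_single (2 ^ k * d)]
    · rw [ih, mul_one]
      exact hone
    · intro i hi hne
      have h1 := two_mul_le_of_entry (i := i) (j := 2 ^ (k + 1) * d) (Finsupp.mem_support_iff.1 hi)
      by_contra hc
      have h2 := le_of_entry_D_pow k d i (right_ne_zero_of_mul hc)
      apply hne
      refine le_antisymm ?_ h2
      rw [pow_succ', mul_assoc] at h1
      exact le_of_mul_le_mul_left' h1
    · intro h
      rw [Finsupp.notMem_support_iff] at h
      change entry (D - 1) (2 ^ k * d) (2 ^ (k + 1) * d) = 0 at h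
      rw [hone] at h
      exact absurd h one_ne_zero

/-- The upper unitriangular matrix whose row `2 ^ k * d`, `d` odd, is row `d` of `(D - 1) ^ k`;
see `entry_Z`. -/
def Z : Module.End ℂ (Col ℕ+) :=
  ofCols fun j => Finsupp.onFinset (Finset.Icc 1 j)
    (fun i => entry ((D - 1) ^ val2 i) (oddPart i) j)
    fun i hi => by
      have := le_of_entry_D_pow _ _ _ hi
      rw [pow_mul_oddPart] at this
      exact Finset.mem_Icc.2 ⟨one_le, this⟩

lemma entry_Z (i j : ℕ+) : entry Z i j = entry ((D - 1) ^ val2 i) (oddPart i) j := by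
  rw [entry, Z, ofCols_single, one_smul, Finsupp.onFinset_apply]

lemma isUnit_Z : IsUnit Z :=
  isUnit_of_unitriangular Z
    (fun j => by
      rw [entry_Z]
      conv_lhs => rw [← pow_mul_oddPart j]
      rw [val2_pow_mul, oddPart_pow_mul]
      exact entry_D_pow_self _ _)
    (fun i j h => by
      rw [entry_Z]
      by_contra hc
      have := le_of_entry_D_pow _ _ _ hc
      rw [pow_mul_oddPart] at this
      exact absurd h (not_lt.2 this))

/-- The map `e_k ↦ e_{2 ^ k * d}`, where `d` is the odd part of `n`. -/
def strand (n : ℕ+) : Col ℕ →ₗ[ℂ] Col ℕ+ :=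
  Finsupp.lmapDomain ℂ ℂ fun k => 2 ^ k * oddPart n

/-- The matrix with entry `A_{k, l}` in position `(2 ^ k * d, 2 ^ l * d)` for all odd `d`, and zeros
elsewhere. -/
def psiFun (A : Module.End ℂ (Col ℕ)) : Module.End ℂ (Col ℕ+) :=
  ofCols fun n => strand n (A (Finsupp.single (val2 n) 1))

lemma psiFun_strand (A : Module.End ℂ (Col ℕ)) (n : ℕ+) (v : Col ℕ) :
    psiFun A (strand n v) = strand n (A v) := by
  have : psiFun A ∘ₗ strand n = strand n ∘ₗ A := by
    ext1 k
    ext1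
    simp only [LinearMap.comp_apply, Finsupp.lsingle_apply]
    rw [strand, Finsupp.lmapDomain_apply, Finsupp.mapDomain_single, psiFun, ofCols_single,
      one_smul, val2_pow_mul, strand, oddPart_pow_mul]
  exact LinearMap.congr_fun this v

/-- `psiFun` is a ring homomorphism. -/
def psi : Module.End ℂ (Col ℕ) →+* Module.End ℂ (Col ℕ+) where
  toFun := psiFun
  map_one' := by
    ext1 n; ext1
    simp [psiFun, strand, pow_mul_oddPart]
  map_zero' := by
    ext1 n; ext1
    simp [psiFun]
  map_add' A B := by
    ext1 n; ext1
    simp [psiFun]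
  map_mul' A B := by
    ext1 n; ext1
    simp only [LinearMap.comp_apply, Finsupp.lsingle_apply, Module.End.mul_apply]
    rw [psiFun, ofCols_single, one_smul, Module.End.mul_apply, ← psiFun_strand]
    congr 1
    rw [psiFun, ofCols_single, one_smul]

/-- The representation `ρ(Y) = Z⁻¹ ψ(P τ₁(Y) P⁻¹) Z`. -/
def rho : SL(2, ℤ) →* (Module.End ℂ (Col ℕ+))ˣ :=
  (MulAut.conj isUnit_Z.unit⁻¹).toMonoidHom.comp
    ((Units.map psi.toMonoidHom).comp ((MulAut.conj isUnit_P.unit).toMonoidHom.comp tau1))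

end Representation

section Dirichlet

open Filter Topology

/-! ### Dirichlet series and the right action of matrices on them -/

/-- The right action `(f A)(n) = ∑ m, a_{m,n} f(m)` of column-finite matrices on sequences. A
sequence `f` is identified with the Dirichlet series `∑ f(n) n ^ (-s)`. -/
def act (f : ℕ+ → ℂ) (A : Module.End ℂ (Col ℕ+)) : ℕ+ → ℂ :=
  fun n => (A (Finsupp.single n 1)).sum fun m z => z * f m

/-- The orbit of `f` under `SL(2, ℤ)`, acting through `rho`. -/
def orbit (f : ℕ+ → ℂ) : Set (ℕ+ → ℂ) :=
  Set.range fun Y : Matrix.SpecialLinearGroup (Fin 2) ℤ => act f (rho Y)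

/-- The Dirichlet series `1`, with the single term `1 ^ (-s)`. -/
def oneSeries : ℕ+ → ℂ := fun n => if n = 1 then 1 else 0

/-- The Dirichlet series `∑ n ^ (-s)`. -/
def zetaSeries : ℕ+ → ℂ := fun _ => 1

/-- The Dirichlet series `φ = 1.ρ(-S)`. -/
def phiSeries : ℕ+ → ℂ := act oneSeries (rho (-ModularGroup.S))

/-- The partial sums `∑_{n = 1}^{N} f(n) n ^ (-s)`. -/
def partialSum (f : ℕ+ → ℂ) (s : ℂ) (N : ℕ) : ℂ :=
  ∑ n ∈ Finset.range N, f n.succPNat * ((n + 1 : ℕ) : ℂ) ^ (-s)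

/-- (Possibly conditional) convergence of the Dirichlet series of `f` at `s`. -/
def ConvergesAt (f : ℕ+ → ℂ) (s : ℂ) : Prop :=
  ∃ l : ℂ, Tendsto (partialSum f s) atTop (𝓝 l)

/-- The sum of the Dirichlet series of `f` at `s` (meaningful where it converges). -/
def seriesSum (f : ℕ+ → ℂ) (s : ℂ) : ℂ := limUnder atTop (partialSum f s)

/-- The abscissa `σ_c` of (conditional) convergence: the infimum of the real `σ` such that the
series converges whenever `Re s > σ`. -/
def abscissa (f : ℕ+ → ℂ) : EReal :=
  sInf (Real.toEReal '' {σ : ℝ | ∀ s : ℂ, σ < s.re → ConvergesAt f s})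

/-! ### The field of meromorphic functions on a half-plane -/

/-- The half-plane `Re s > a`. -/
def halfPlane (a : ℝ) : Set ℂ := {s | a < s.re}

lemma isOpen_halfPlane (a : ℝ) : IsOpen (halfPlane a) :=
  isOpen_lt continuous_const Complex.continuous_re

lemma isConnected_halfPlane (a : ℝ) : IsConnected (halfPlane a) :=
  ⟨⟨((a + 1 : ℝ) : ℂ), by simp [halfPlane]⟩, (convex_halfSpace_re_gt a).isPreconnected⟩

lemma codiscreteWithin_halfPlane_neBot (a : ℝ) : (codiscreteWithin (halfPlane a)).NeBot := by
  rw [neBot_iff, ne_eq, ← empty_mem_iff_bot, mem_codiscreteWithin_iff_forall_mem_nhdsNE]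
  intro h
  obtain ⟨x, hx⟩ := (isConnected_halfPlane a).nonempty
  have h1 := h x hx
  rw [Set.empty_union] at h1
  have h2 : halfPlane a ∈ 𝓝[≠] x := mem_nhdsWithin_of_mem_nhds ((isOpen_halfPlane a).mem_nhds hx)
  have h3 := inter_mem h1 h2
  rw [Set.compl_inter_self] at h3
  exact (NeBot.ne inferInstance) (empty_mem_iff_bot.1 h3)

/-- Meromorphic functions on `Re s > a`, two of them being identified when they agree off a closed
discrete subset of the half-plane. -/
def meroSubring (a : ℝ) : Subring (Germ (codiscreteWithin (halfPlane a)) ℂ) where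
  carrier := {g | ∃ f : ℂ → ℂ, MeromorphicOn f (halfPlane a) ∧ g = (f : Germ _ ℂ)}
  mul_mem' := by
    rintro _ _ ⟨f, hf, rfl⟩ ⟨g, hg, rfl⟩
    exact ⟨f * g, hf.mul hg, rfl⟩
  one_mem' := ⟨fun _ => 1, MeromorphicOn.const 1, rfl⟩
  add_mem' := by
    rintro _ _ ⟨f, hf, rfl⟩ ⟨g, hg, rfl⟩
    exact ⟨f + g, hf.add hg, rfl⟩
  zero_mem' := ⟨fun _ => 0, MeromorphicOn.const 0, rfl⟩
  neg_mem' := by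
    rintro _ ⟨f, hf, rfl⟩
    exact ⟨-f, hf.neg, rfl⟩

/-- The field of meromorphic functions on the half-plane `Re s > a`. -/
def Mero (a : ℝ) : Type := meroSubring a

instance (a : ℝ) : CommRing (Mero a) := inferInstanceAs (CommRing (meroSubring a))

/-- The element of `Mero a` given by a function that is meromorphic on the half-plane. -/
def Mero.mk {a : ℝ} (f : ℂ → ℂ) (hf : MeromorphicOn f (halfPlane a)) : Mero a :=
  ⟨(f : Germ _ ℂ), f, hf, rfl⟩

lemma Mero.mk_eq_mk_iff {a : ℝ} {f g : ℂ → ℂ} (hf : MeromorphicOn f (halfPlane a))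
    (hg : MeromorphicOn g (halfPlane a)) :
    Mero.mk f hf = Mero.mk g hg ↔ f =ᶠ[codiscreteWithin (halfPlane a)] g :=
  Subtype.ext_iff.trans Germ.coe_eq

lemma Mero.isField (a : ℝ) : IsField (Mero a) where
  exists_pair_ne := by
    have := codiscreteWithin_halfPlane_neBot a
    refine ⟨0, 1, fun h => ?_⟩
    have h2 := congrArg Subtype.val h
    exact zero_ne_one (α := Germ (codiscreteWithin (halfPlane a)) ℂ) h2
  mul_comm := mul_comm
  mul_inv_cancel := by
    rintro ⟨_, f, hf, rfl⟩ hne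
    have hU := isOpen_halfPlane a
    have hconn := isConnected_halfPlane a
    have hex : ∃ u : halfPlane a, meromorphicOrderAt f u ≠ ⊤ := by
      by_contra! hc
      apply hne
      apply Subtype.ext
      refine Germ.coe_eq.2 ?_
      rw [EventuallyEq, Filter.Eventually, mem_codiscreteWithin_iff_forall_mem_nhdsNE]
      intro x hx
      have h1 := meromorphicOrderAt_eq_top_iff.1 (hc ⟨x, hx⟩)
      filter_upwards [h1] with y hy
      exact Or.inl hy
    have hall := (hf.exists_meromorphicOrderAt_ne_top_iff_forall hconn).1 hex
    refine ⟨Mero.mk f⁻¹ hf.inv, ?_⟩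
    apply Subtype.ext
    refine Germ.coe_eq.2 ?_
    rw [EventuallyEq, Filter.Eventually, mem_codiscreteWithin_iff_forall_mem_nhdsNE]
    intro x hx
    have h1 := (meromorphicOrderAt_ne_top_iff_eventually_ne_zero (hf x hx)).1 (hall ⟨x, hx⟩)
    filter_upwards [h1] with y hy
    exact Or.inl (mul_inv_cancel₀ hy)

instance (a : ℝ) : Field (Mero a) := (Mero.isField a).toField

instance (a : ℝ) : Algebra ℂ (Mero a) :=
  RingHom.toAlgebra
    { toFun := fun c => Mero.mk (fun _ => c) (MeromorphicOn.const c)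
      map_one' := rfl
      map_mul' := fun _ _ => rfl
      map_zero' := rfl
      map_add' := fun _ _ => rfl }

end Dirichlet

end DivisorSL2

end

/-!
A block Toeplitz matrix with `2 × 2` blocks is a `2 × 2` matrix over `ℂ⟦X⟧`. The matrix `J` of
`τ₁(T)` has determinant `1` and trace `2 + X`, because `g = ∑ bₙ Xⁿ` satisfies `g + g² = X`; hence
`J + J⁻¹` is the scalar matrix `2 + X`.

Conjugation by `P` and `Z` turns `J` into the divisor matrix, that is, into multiplication by `ζ`.
In particular `1.ρ(T) = ζ`, and the scalar matrix `X` acts as multiplication by `ζ + ζ⁻¹ - 2`. Every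
power series over `ℤ`, as a scalar matrix, then acts as multiplication by some Dirichlet series:
truncating it costs a term divisible by a high power of `ζ + ζ⁻¹ - 2`, which has no constant term,
so that only coefficients of large index are affected.

If `f` is the action of `S`, then `f (ζ F) + f (ζ⁻¹ F) = (ζ + ζ⁻¹) f F`, since `J + J⁻¹` is central.
This two-term recursion, started at `F = 1, ζ, φ, ζ φ`, shows that `S` preserves the additive group
generated by all `ζ ^ m` and `φ ζ ^ m`, which therefore contains the orbit of `1`.

The same computation gives `φ = z + z² - z φ - z φ²` with `z = ζ - 1`. For `Re s ≥ 4` the norms of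
the terms of `z` add up to at most `1 / 4`, so by induction those of `φ` add up to at most `1`, and
`σ_c` is not `+∞`. By Mertens' theorem, multiplication by the absolutely convergent series `ζ` and
`ζ⁻¹` preserves convergence for `Re s > max 1 σ_c`, and summation by parts makes the sums analytic.
-/

noncomputable section

namespace DivisorSL2

section MatrixRows

open PowerSeries Matrix MatrixGroups

lemma end_ext_entry {ι : Type} {A B : Module.End ℂ (Col ι)}
    (h : ∀ i j, entry A i j = entry B i j) : A = B := by
  ext1 j
  ext1
  exact Finsupp.ext fun i => h i j

/-- The monoid of column-finite matrices whose row `i` is that of the identity matrix. -/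
def unitRow {ι : Type} (i : ι) : Submonoid (Module.End ℂ (Col ι)) where
  carrier := {A | ∀ j, entry A i j = entry 1 i j}
  one_mem' _ := rfl
  mul_mem' {A B} hA hB j := by
    calc entry (A * B) i j = entry (1 * B) i j := by simp only [entry_mul, hA _]
      _ = entry 1 i j := by rw [one_mul, hB]

lemma inv_mem_unitRow {ι : Type} {i : ι} {u : (Module.End ℂ (Col ι))ˣ}
    (hu : (u : Module.End ℂ (Col ι)) ∈ unitRow i) :
    (↑u⁻¹ : Module.End ℂ (Col ι)) ∈ unitRow i := fun j => by
  calc entry ↑u⁻¹ i j = entry (1 * ↑u⁻¹) i j := by rw [one_mul]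
    _ = entry (↑u * ↑u⁻¹) i j := by simp only [entry_mul, hu _]
    _ = entry 1 i j := by rw [u.mul_inv]

/-- The shift matrix, with ones just above the diagonal. -/
def shift : Module.End ℂ (Col ℕ) :=
  ofCols fun j => if j = 0 then 0 else Finsupp.single (j - 1) 1

lemma entry_shift (i j : ℕ) : entry shift i j = if j = i + 1 then 1 else 0 := by
  rw [entry, shift, ofCols_single, one_smul]
  rcases j with _ | j
  · simp
  · simp [Finsupp.single_apply]

lemma entry_mul_of_entry_eq_ite {ι : Type} [DecidableEq ι] {A : Module.End ℂ (Col ι)} {i k : ι}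
    (hA : ∀ j, entry A i j = if j = k then 1 else 0) (B : Module.End ℂ (Col ι)) (j : ι) :
    entry (A * B) i j = entry B k j := by
  rw [entry_mul]
  simp only [hA, mul_ite, mul_one, mul_zero, Finsupp.sum_ite_eq', Finsupp.mem_support_iff]
  exact ite_not _ _ _ |>.trans (ite_eq_right_iff.2 Eq.symm)

lemma P_mul_Jt : P * Jt = (shift + 1) * P := by
  have hP : P * (Jt - 1) = shift * P := end_ext_entry fun n j => by
    rw [entry_mul_of_entry_eq_ite (entry_shift n), entry_P, pow_succ, entry_mul, entry_mul]
    simp only [entry_P]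
  rw [add_mul, one_mul]
  exact sub_eq_iff_eq_add.1 ((mul_sub_one P Jt).symm.trans hP)

lemma val2_two_mul (n : ℕ+) : val2 (2 * n) = val2 n + 1 := by
  conv_lhs => rw [← pow_mul_oddPart n, ← mul_assoc, ← pow_succ', val2_pow_mul]

lemma oddPart_two_mul (n : ℕ+) : oddPart (2 * n) = oddPart n := by
  conv_lhs => rw [← pow_mul_oddPart n, ← mul_assoc, ← pow_succ', oddPart_pow_mul]

lemma val2_one : val2 1 = 0 := by simp [val2]

lemma oddPart_one : oddPart 1 = 1 := PNat.eq (by simp [oddPart])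

lemma entry_psi (A : Module.End ℂ (Col ℕ)) (m n : ℕ+) :
    entry (psi A) m n = strand n (A (Finsupp.single (val2 n) 1)) m := by
  change psiFun A _ _ = _
  rw [psiFun, ofCols_single, one_smul]

lemma entry_psi_shift (m n : ℕ+) : entry (psi shift) m n = if n = 2 * m then 1 else 0 := by
  rw [entry_psi, shift, ofCols_single, one_smul]
  by_cases h : val2 n = 0
  · rw [if_pos h, map_zero, Finsupp.zero_apply, if_neg]
    rintro rfl
    rw [val2_two_mul] at h
    omega
  · rw [if_neg h, strand, Finsupp.lmapDomain_apply, Finsupp.mapDomain_single,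
      Finsupp.single_apply]
    refine if_congr ⟨fun hm => ?_, ?_⟩ rfl rfl
    · rw [← hm, ← mul_assoc, ← pow_succ', Nat.sub_add_cancel (Nat.pos_of_ne_zero h),
        pow_mul_oddPart]
    · rintro rfl
      rw [val2_two_mul, oddPart_two_mul, Nat.add_sub_cancel, pow_mul_oddPart]

lemma Z_mul_D : Z * D = psi (shift + 1) * Z := by
  have hZ : Z * (D - 1) = psi shift * Z := end_ext_entry fun m n => by
    rw [entry_mul_of_entry_eq_ite (entry_psi_shift m), entry_Z, val2_two_mul, oddPart_two_mul,
      pow_succ, entry_mul, entry_mul]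
    simp only [entry_Z]
  rw [map_add, map_one, add_mul, one_mul]
  exact sub_eq_iff_eq_add.1 ((mul_sub_one Z D).symm.trans hZ)

lemma strand_apply_one (n : ℕ+) (v : Col ℕ) :
    strand n v 1 = if oddPart n = 1 then v 0 else 0 := by
  have hk (k : ℕ) : 2 ^ k * oddPart n = 1 ↔ oddPart n = 1 ∧ k = 0 := by
    refine ⟨fun h => ?_, ?_⟩
    · have hodd := oddPart_pow_mul k n
      have hval := val2_pow_mul k n
      rw [h] at hodd hval
      exact ⟨hodd.symm.trans oddPart_one, hval.symm.trans val2_one⟩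
    · rintro ⟨h, rfl⟩
      rw [h, pow_zero, mul_one]
  induction v using Finsupp.induction_linear with
  | zero => simp
  | add v w hv hw => rw [map_add, Finsupp.add_apply, hv, hw]; split_ifs <;> simp
  | single k c =>
    rw [strand, Finsupp.lmapDomain_apply, Finsupp.mapDomain_single, Finsupp.single_apply,
      Finsupp.single_apply, ← ite_and]
    exact if_congr (hk k) rfl rfl

lemma psi_mem_unitRow {A : Module.End ℂ (Col ℕ)} (hA : A ∈ unitRow 0) : psi A ∈ unitRow 1 :=
  fun n => by
    rw [← map_one psi, entry_psi, entry_psi, strand_apply_one, strand_apply_one]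
    exact if_congr Iff.rfl (hA _) rfl

lemma toeplitz_mem_unitRow {M : Matrix (Fin 2) (Fin 2) ℂ⟦X⟧} (hM : M 0 = ![1, 0]) :
    toeplitz M ∈ unitRow 0 := fun j => by
  obtain ⟨c, b, rfl⟩ := exists_fin_two j
  have h (M : Matrix (Fin 2) (Fin 2) ℂ⟦X⟧) := entry_toeplitz M 0 c 0 b
  simp only [Fin.coe_ofNat_eq_mod, Nat.zero_mod, add_zero, mul_zero] at h
  rw [← map_one toeplitz, h, h, hM]
  fin_cases b <;> rfl

lemma P_mem_unitRow : P ∈ unitRow 0 := fun j => by rw [entry_P, pow_zero]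

lemma Z_mem_unitRow : Z ∈ unitRow 1 := fun n => by
  rw [entry_Z, val2_one, oddPart_one, pow_zero]

/-- The ring homomorphism `M ↦ Z⁻¹ ψ(P M P⁻¹) Z` on matrices of power series, a matrix `M` being
identified with its block Toeplitz matrix. It extends `ρ`; see `rho_S` and `rho_T`. -/
def rhoMat : Matrix (Fin 2) (Fin 2) ℂ⟦X⟧ →+* Module.End ℂ (Col ℕ+) :=
  (MulSemiringAction.toRingHom _ _ (ConjAct.toConjAct isUnit_Z.unit⁻¹)).comp
    (psi.comp ((MulSemiringAction.toRingHom _ _ (ConjAct.toConjAct isUnit_P.unit)).comp toeplitz))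

lemma rhoMat_apply (M : Matrix (Fin 2) (Fin 2) ℂ⟦X⟧) :
    rhoMat M = ↑isUnit_Z.unit⁻¹ * psi (P * toeplitz M * ↑isUnit_P.unit⁻¹) * Z := by
  rfl

lemma rhoMat_mem_unitRow {M : Matrix (Fin 2) (Fin 2) ℂ⟦X⟧} (hM : M 0 = ![1, 0]) :
    rhoMat M ∈ unitRow 1 :=
  mul_mem (mul_mem (inv_mem_unitRow Z_mem_unitRow) (psi_mem_unitRow
    (mul_mem (mul_mem P_mem_unitRow (toeplitz_mem_unitRow hM)) (inv_mem_unitRow P_mem_unitRow))))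
    Z_mem_unitRow

/-- The matrix of power series whose Toeplitz matrix is `τ₁(S)`. -/
def sMat : Matrix (Fin 2) (Fin 2) ℂ⟦X⟧ := !![0, -1; 1, 0]

/-- The matrix of power series whose Toeplitz matrix is `τ₁(T)`. -/
def jMat : Matrix (Fin 2) (Fin 2) ℂ⟦X⟧ := !![1, 1 + gSeries; gSeries, 1 + X]

lemma coe_rho (Y : SL(2, ℤ)) : (rho Y : Module.End ℂ (Col ℕ+)) =
    ↑isUnit_Z.unit⁻¹ * psi (P * tau1 Y * ↑isUnit_P.unit⁻¹) * Z := rfl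

lemma rho_S : (rho ModularGroup.S : Module.End ℂ (Col ℕ+)) = rhoMat sMat := by
  rw [coe_rho, tau1_S, St, blockMatrix_sBlock, rhoMat_apply, sMat]

lemma rho_T : (rho ModularGroup.T : Module.End ℂ (Col ℕ+)) = rhoMat jMat := by
  rw [coe_rho, tau1_T, Jt, blockMatrix_jBlock, rhoMat_apply, jMat]

lemma rhoMat_jMat : rhoMat jMat = D := by
  rw [← rho_T, coe_rho, tau1_T, P_mul_Jt, mul_assoc _ P, IsUnit.mul_val_inv, mul_one, mul_assoc,
    ← Z_mul_D, ← mul_assoc, IsUnit.val_inv_mul, one_mul]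

lemma det_jMat : jMat.det = 1 := by
  rw [jMat, det_fin_two_of, ← gSeries_sq_add]
  ring

lemma jMat_add_adjugate : jMat + jMat.adjugate = (2 + X : ℂ⟦X⟧) • 1 := by
  rw [jMat, adjugate_fin_two_of]
  ext1 i j
  fin_cases i <;> fin_cases j <;> simp <;> ring

end MatrixRows

section ArithmeticFunctions

open PowerSeries

variable {R : Type*} [CommRing R]

lemma arith_pow_mul_apply_eq_zero {F : ArithmeticFunction R} (hF : F 1 = 0)
    (E : ArithmeticFunction R) (k : ℕ) : ∀ n < 2 ^ k, (F ^ k * E) n = 0 := by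
  induction k with
  | zero =>
    intro n hn
    obtain rfl : n = 0 := by simpa using hn
    exact ArithmeticFunction.map_zero
  | succ k ih =>
    intro n hn
    rw [pow_succ', mul_assoc, ArithmeticFunction.mul_apply]
    refine Finset.sum_eq_zero fun ⟨d, e⟩ h => ?_
    obtain ⟨rfl, hn0⟩ := Nat.mem_divisorsAntidiagonal.1 h
    obtain rfl | hd : d = 1 ∨ 2 ≤ d := by
      have := left_ne_zero_of_mul hn0
      omega
    · rw [hF, zero_mul]
    · have he : e < 2 ^ k := by
        rw [pow_succ'] at hn
        nlinarith
      rw [ih e he, mul_zero]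

lemma powerSeries_apply_eq_mul (f : ℤ⟦X⟧ →+ (ArithmeticFunction R →+ ArithmeticFunction R))
    {τ : ArithmeticFunction R} (hτ : τ 1 = 0) (f_one : ∀ F, f 1 F = F)
    (f_X_mul : ∀ x F, f (X * x) F = τ * f x F) (x : ℤ⟦X⟧) (F : ArithmeticFunction R) :
    f x F = f x 1 * F := by
  have hdvd (k : ℕ) : ∀ x : ℤ⟦X⟧, ∃ E, f x F - f x 1 * F = τ ^ k * E := by
    induction k with
    | zero => exact fun x => ⟨_, by rw [pow_zero, one_mul]⟩
    | succ k ih =>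
      intro x
      obtain ⟨E, hE⟩ := ih (PowerSeries.mk fun p => coeff (p + 1) x)
      refine ⟨E, ?_⟩
      have hx (G) : f x G = τ * f (PowerSeries.mk fun p => coeff (p + 1) x) G +
          constantCoeff x * G := by
        conv_lhs => rw [eq_X_mul_shift_add_const x, eq_intCast C, ← zsmul_one, map_add, map_zsmul]
        rw [AddMonoidHom.add_apply, f_X_mul, AddMonoidHom.zsmul_apply, f_one, zsmul_eq_mul]
      rw [hx, hx, pow_succ', mul_assoc, ← hE]
      ring
  rw [← sub_eq_zero]
  ext n
  obtain ⟨E, hE⟩ := hdvd n x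
  rw [hE, arith_pow_mul_apply_eq_zero hτ E n n Nat.lt_two_pow_self, ArithmeticFunction.zero_apply]

end ArithmeticFunctions

section RightAction

open scoped ArithmeticFunction.zeta ArithmeticFunction.Moebius

lemma act_apply (f : ℕ+ → ℂ) (A : Module.End ℂ (Col ℕ+)) (n : ℕ+) :
    act f A n = Finsupp.linearCombination ℂ f (A (Finsupp.single n 1)) := rfl

lemma linearCombination_act (f : ℕ+ → ℂ) (A : Module.End ℂ (Col ℕ+)) :
    Finsupp.linearCombination ℂ (act f A) = Finsupp.linearCombination ℂ f ∘ₗ A := by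
  ext1 n
  ext1
  simp [act_apply]

lemma act_mul (f : ℕ+ → ℂ) (A B : Module.End ℂ (Col ℕ+)) :
    act f (A * B) = act (act f A) B := by
  funext n
  rw [act_apply, act_apply, linearCombination_act]
  rfl

lemma act_one (f : ℕ+ → ℂ) : act f 1 = f := by
  funext n
  simp [act_apply]

lemma act_oneSeries (A : Module.End ℂ (Col ℕ+)) (n : ℕ+) : act oneSeries A n = entry A 1 n := by
  rw [act, entry]
  simp only [oneSeries, mul_ite, mul_one, mul_zero, Finsupp.sum_ite_eq', Finsupp.mem_support_iff]
  exact (ite_not _ _ _).trans (ite_eq_right_iff.2 Eq.symm)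

lemma orbit_act (f : ℕ+ → ℂ) (Y : Matrix.SpecialLinearGroup (Fin 2) ℤ) :
    orbit (act f (rho Y)) = orbit f := by
  have h (W) : act (act f (rho Y)) (rho W) = act f (rho (Y * W)) := by
    rw [map_mul, Units.val_mul, act_mul]
  simp only [orbit, h]
  exact (Equiv.mulLeft Y).surjective.range_comp fun W => act f (rho W)

/-- Sequences on the positive integers, viewed as arithmetic functions. The Dirichlet convolution
of arithmetic functions is the product of formal Dirichlet series. -/
def toArith : (ℕ+ → ℂ) ≃+ ArithmeticFunction ℂ := AddEquiv.symm
  { toFun := fun F n => F n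
    invFun := fun f => ⟨fun n => if h : 0 < n then f ⟨n, h⟩ else 0, by simp⟩
    left_inv := fun F => by
      ext n
      obtain rfl | hn := n.eq_zero_or_pos
      · simp
      · exact dif_pos hn
    right_inv := fun f => funext fun n => dif_pos n.pos
    map_add' := fun _ _ => rfl }

lemma toArith_apply (f : ℕ+ → ℂ) (n : ℕ+) : toArith f n = f n := dif_pos n.pos

lemma toArith_oneSeries : toArith oneSeries = 1 := by
  rw [← AddEquiv.eq_symm_apply]
  funext n
  exact if_congr PNat.coe_eq_one_iff.symm rfl rfl

/-- The right action of a column-finite matrix on formal Dirichlet series. -/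
def actHom (A : Module.End ℂ (Col ℕ+)) : ArithmeticFunction ℂ →+ ArithmeticFunction ℂ :=
  AddMonoidHom.mk' (fun F => toArith (act (toArith.symm F) A)) fun F G => by
    rw [← map_add]
    congr 1
    funext n
    simp only [act, map_add, Pi.add_apply, mul_add, Finsupp.sum_add]

lemma actHom_toArith (f : ℕ+ → ℂ) (A : Module.End ℂ (Col ℕ+)) :
    actHom A (toArith f) = toArith (act f A) := by
  change toArith (act (toArith.symm (toArith f)) A) = _
  rw [AddEquiv.symm_apply_apply]

lemma actHom_mul (A B : Module.End ℂ (Col ℕ+)) (F : ArithmeticFunction ℂ) :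
    actHom (A * B) F = actHom B (actHom A F) := by
  obtain ⟨f, rfl⟩ := toArith.surjective F
  simp only [actHom_toArith, act_mul]

lemma actHom_one (F : ArithmeticFunction ℂ) : actHom 1 F = F := by
  obtain ⟨f, rfl⟩ := toArith.surjective F
  rw [actHom_toArith, act_one]

lemma actHom_add (A B : Module.End ℂ (Col ℕ+)) (F : ArithmeticFunction ℂ) :
    actHom (A + B) F = actHom A F + actHom B F := by
  obtain ⟨f, rfl⟩ := toArith.surjective F
  simp only [actHom_toArith, ← map_add]
  congr 1
  funext n
  simp only [act_apply, LinearMap.add_apply, map_add, Pi.add_apply]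

lemma actHom_D (F : ArithmeticFunction ℂ) : actHom D F = (ζ : ArithmeticFunction ℂ) * F := by
  obtain ⟨f, rfl⟩ := toArith.surjective F
  rw [actHom_toArith, ← AddEquiv.eq_symm_apply]
  funext n
  change _ = ((ζ : ArithmeticFunction ℂ) * toArith f) n
  rw [act_apply, D, ofCols_single, one_smul, map_sum, ArithmeticFunction.coe_zeta_mul_apply]
  simp only [Finsupp.linearCombination_single, one_smul]
  refine Finset.sum_nbij (fun i : ℕ+ => (i : ℕ)) (fun i hi => ?_)
    (fun _ _ _ _ => PNat.eq) (fun d hd => ?_) (fun i _ => (toArith_apply f i).symm)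
  · exact Nat.mem_divisors.2 ⟨(Finset.mem_filter.1 hi).2, n.ne_zero⟩
  · have hdn := Nat.dvd_of_mem_divisors hd
    exact ⟨⟨d, Nat.pos_of_mem_divisors hd⟩, Finset.mem_filter.2
      ⟨Finset.mem_Icc.2 ⟨one_le, Nat.le_of_dvd n.pos hdn⟩, hdn⟩, rfl⟩

lemma zetaSeries_eq_act : zetaSeries = act oneSeries (rho ModularGroup.T) := by
  rw [rho_T, rhoMat_jMat]
  funext n
  rw [act_oneSeries, entry_D, PNat.one_coe, if_pos (one_dvd _), zetaSeries]

end RightAction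

section ZpowSpan

variable {R : Type*} [CommRing R]

/-- The additive subgroup generated by the elements `u ^ m` and `y * u ^ m`, for `m ∈ ℤ`. -/
def zpowSpan (u : Rˣ) (y : R) : AddSubgroup R :=
  AddSubgroup.closure ({x | ∃ m : ℤ, x = ↑(u ^ m)} ∪ {x | ∃ m : ℤ, x = y * ↑(u ^ m)})

variable {u : Rˣ} {y : R}

lemma zpow_mem_zpowSpan (m : ℤ) : ↑(u ^ m) ∈ zpowSpan u y :=
  AddSubgroup.subset_closure (Or.inl ⟨m, rfl⟩)

lemma mul_zpow_mem_zpowSpan (m : ℤ) : y * ↑(u ^ m) ∈ zpowSpan u y :=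
  AddSubgroup.subset_closure (Or.inr ⟨m, rfl⟩)

lemma zpowSpan_le {H : AddSubgroup R} (h_zpow : ∀ m : ℤ, ↑(u ^ m) ∈ H)
    (h_mul : ∀ m : ℤ, y * ↑(u ^ m) ∈ H) : zpowSpan u y ≤ H := by
  rw [zpowSpan, AddSubgroup.closure_le]
  rintro _ (⟨m, rfl⟩ | ⟨m, rfl⟩)
  exacts [h_zpow m, h_mul m]

lemma zpow_mul_mem_zpowSpan (k : ℤ) {x : R} (hx : x ∈ zpowSpan u y) :
    ↑(u ^ k) * x ∈ zpowSpan u y := by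
  suffices zpowSpan u y ≤ (zpowSpan u y).comap (AddMonoidHom.mulLeft ↑(u ^ k)) from this hx
  refine zpowSpan_le (fun m => ?_) (fun m => ?_)
  · rw [AddSubgroup.mem_comap, AddMonoidHom.coe_mulLeft, ← Units.val_mul, ← zpow_add]
    exact zpow_mem_zpowSpan _
  · rw [AddSubgroup.mem_comap, AddMonoidHom.coe_mulLeft, mul_left_comm, ← Units.val_mul,
      ← zpow_add]
    exact mul_zpow_mem_zpowSpan _

lemma one_mem_zpowSpan : 1 ∈ zpowSpan u y := by
  simpa only [zpow_zero, Units.val_one] using zpow_mem_zpowSpan (u := u) (y := y) 0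

lemma right_mem_zpowSpan : y ∈ zpowSpan u y := by
  simpa only [zpow_zero, Units.val_one, mul_one] using mul_zpow_mem_zpowSpan (u := u) (y := y) 0

lemma unit_mul_mem_zpowSpan {x : R} (hx : x ∈ zpowSpan u y) : u * x ∈ zpowSpan u y := by
  simpa only [zpow_one] using zpow_mul_mem_zpowSpan 1 hx

lemma inv_mul_mem_zpowSpan {x : R} (hx : x ∈ zpowSpan u y) : ↑u⁻¹ * x ∈ zpowSpan u y := by
  simpa only [zpow_neg_one] using zpow_mul_mem_zpowSpan (-1) hx

lemma map_mul_zpow_mem_zpowSpan {f : R →+ R}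
    (hf : ∀ x, f (u * x) + f (↑u⁻¹ * x) = (u + ↑u⁻¹) * f x) {x : R} (h0 : f x ∈ zpowSpan u y)
    (h1 : f (x * u) ∈ zpowSpan u y) (m : ℤ) : f (x * ↑(u ^ m)) ∈ zpowSpan u y := by
  have hrec (k : ℤ) : f (x * ↑(u ^ (k + 1))) + f (x * ↑(u ^ (k - 1))) =
      (u + ↑u⁻¹) * f (x * ↑(u ^ k)) := by
    rw [← hf, zpow_add_one, zpow_sub_one, Units.val_mul, Units.val_mul]
    ring_nf
  have hmul {z : R} (hz : z ∈ zpowSpan u y) : (u + ↑u⁻¹) * z ∈ zpowSpan u y := by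
    rw [add_mul]
    exact add_mem (unit_mul_mem_zpowSpan hz) (inv_mul_mem_zpowSpan hz)
  suffices f (x * ↑(u ^ m)) ∈ zpowSpan u y ∧ f (x * ↑(u ^ (m + 1))) ∈ zpowSpan u y from this.1
  induction m using Int.induction_on with
  | zero => simpa only [zpow_zero, Units.val_one, mul_one, zero_add, zpow_one] using ⟨h0, h1⟩
  | succ i ih =>
    refine ⟨ih.2, ?_⟩
    rw [eq_sub_of_add_eq (hrec (i + 1)), add_sub_cancel_right]
    exact sub_mem (hmul ih.2) ih.1
  | pred i ih =>
    refine ⟨?_, by rw [sub_add_cancel]; exact ih.1⟩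
    rw [eq_sub_of_add_eq' (hrec (-i))]
    exact sub_mem (hmul ih.1) ih.2

lemma map_mem_zpowSpan {f : R →+ R}
    (hf : ∀ x, f (u * x) + f (↑u⁻¹ * x) = (u + ↑u⁻¹) * f x) (h_one : f 1 ∈ zpowSpan u y)
    (h_u : f u ∈ zpowSpan u y) (h_y : f y ∈ zpowSpan u y) (h_mul : f (y * u) ∈ zpowSpan u y)
    {x : R} (hx : x ∈ zpowSpan u y) : f x ∈ zpowSpan u y := by
  suffices zpowSpan u y ≤ (zpowSpan u y).comap f from this hx
  refine zpowSpan_le (fun m => ?_) (map_mul_zpow_mem_zpowSpan hf h_y h_mul)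
  rw [← one_mul (↑(u ^ m) : R)]
  exact map_mul_zpow_mem_zpowSpan hf h_one (by rwa [one_mul]) m

lemma zpowSpan_mk0 {K : Type*} [Field K] {x : K} (hx : x ≠ 0) (y : K) :
    zpowSpan (Units.mk0 x hx) y =
      AddSubgroup.closure ({z | ∃ m : ℤ, z = x ^ m} ∪ {z | ∃ m : ℤ, z = y * x ^ m}) := by
  simp only [zpowSpan, Units.val_zpow_eq_zpow_val, Units.val_mk0]

lemma mem_adjoin_of_mem_zpowSpan_mk0 (k : Type*) {K : Type*} [Field k] [Field K] [Algebra k K]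
    {x y z : K} (hx : x ≠ 0) (hz : z ∈ zpowSpan (Units.mk0 x hx) y) :
    z ∈ IntermediateField.adjoin k {x, y} := by
  have hxF : x ∈ IntermediateField.adjoin k {x, y} :=
    IntermediateField.subset_adjoin _ _ (Set.mem_insert _ _)
  have hyF : y ∈ IntermediateField.adjoin k {x, y} :=
    IntermediateField.subset_adjoin _ _ (Set.mem_insert_of_mem _ rfl)
  suffices zpowSpan (Units.mk0 x hx) y ≤
    (IntermediateField.adjoin k {x, y}).toSubring.toAddSubgroup from this hz
  refine zpowSpan_le (fun m => ?_) (fun m => ?_)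
  · rw [Units.val_zpow_eq_zpow_val]
    exact zpow_mem hxF m
  · rw [Units.val_zpow_eq_zpow_val]
    exact IntermediateField.mul_mem _ hyF (zpow_mem hxF m)

end ZpowSpan

section RowSeries

open PowerSeries Matrix MatrixGroups
open scoped ArithmeticFunction.zeta ArithmeticFunction.Moebius

/-- The formal Dirichlet series obtained by letting the block Toeplitz matrix with first row `v`
act, after conjugation as in `rhoMat`, on the series `1`. -/
def rowSeries : (Fin 2 → ℂ⟦X⟧) →+ ArithmeticFunction ℂ :=
  AddMonoidHom.mk' (fun v => actHom (rhoMat (of ![v, 0])) 1) fun v w => by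
    rw [← actHom_add, ← map_add, of_add_of, cons_add_cons, cons_add_cons, add_zero, empty_add_empty]

lemma rowSeries_apply (v : Fin 2 → ℂ⟦X⟧) : rowSeries v = actHom (rhoMat (of ![v, 0])) 1 := by
  rw [rowSeries, AddMonoidHom.mk'_apply]

lemma rowSeries_vecMul (v : Fin 2 → ℂ⟦X⟧) (M : Matrix (Fin 2) (Fin 2) ℂ⟦X⟧) :
    rowSeries (v ᵥ* M) = actHom (rhoMat M) (rowSeries v) := by
  rw [rowSeries_apply, rowSeries_apply, ← actHom_mul, ← map_mul, cons_mul, cons_mul, zero_vecMul,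
    empty_mul]
  rfl

lemma rowSeries_one : rowSeries ![1, 0] = 1 := by
  rw [rowSeries_apply, ← toArith_oneSeries, actHom_toArith]
  congr 1
  funext n
  rw [act_oneSeries, rhoMat_mem_unitRow rfl, ← act_oneSeries, act_one]

lemma actHom_jMat (F : ArithmeticFunction ℂ) :
    actHom (rhoMat jMat) F = (ζ : ArithmeticFunction ℂ) * F := by
  rw [rhoMat_jMat, actHom_D]

lemma actHom_adjugate_jMat (F : ArithmeticFunction ℂ) :
    actHom (rhoMat jMat.adjugate) F = (μ : ArithmeticFunction ℂ) * F := by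
  have h : (ζ : ArithmeticFunction ℂ) * actHom (rhoMat jMat.adjugate) F = F := by
    rw [← actHom_jMat, ← actHom_mul, ← map_mul, adjugate_mul, det_jMat, one_smul, map_one,
      actHom_one]
  rw [← h, ← mul_assoc, ArithmeticFunction.coe_moebius_mul_coe_zeta, one_mul, h]

/-- The formal Dirichlet series by which the scalar matrix `X` acts. -/
def tauSeries : ArithmeticFunction ℂ := ((ζ : ArithmeticFunction ℂ) - 1) + (μ - 1)

lemma tauSeries_apply_one : tauSeries 1 = 0 := by
  rw [tauSeries, sub_eq_add_neg, sub_eq_add_neg]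
  simp

lemma actHom_X_smul_one (F : ArithmeticFunction ℂ) :
    actHom (rhoMat ((X : ℂ⟦X⟧) • 1)) F = tauSeries * F := by
  have h := actHom_add (rhoMat jMat) (rhoMat jMat.adjugate) F
  rw [← map_add, jMat_add_adjugate, add_smul, map_add, actHom_add, actHom_jMat,
    actHom_adjugate_jMat, two_smul, map_add, actHom_add, map_one, actHom_one] at h
  rw [tauSeries]
  linear_combination h

lemma actHom_trace (M : Matrix (Fin 2) (Fin 2) ℂ⟦X⟧) (F : ArithmeticFunction ℂ) :
    actHom (rhoMat M) ((ζ : ArithmeticFunction ℂ) * F) +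
      actHom (rhoMat M) ((μ : ArithmeticFunction ℂ) * F) =
    ((ζ : ArithmeticFunction ℂ) + μ) * actHom (rhoMat M) F := by
  simp only [add_mul, ← actHom_jMat, ← actHom_adjugate_jMat, ← actHom_mul, ← actHom_add,
    ← map_mul, ← map_add]
  rw [← add_mul, ← mul_add, jMat_add_adjugate, smul_mul_assoc, one_mul, mul_smul_comm, mul_one]

lemma rowSeries_X_smul (v : Fin 2 → ℂ⟦X⟧) :
    rowSeries ((X : ℂ⟦X⟧) • v) = tauSeries * rowSeries v := by
  rw [← actHom_X_smul_one, ← rowSeries_vecMul, vecMul_smul, vecMul_one]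

/-- The action of scalar matrices with integral power series as entries. -/
def scalarHom : ℤ⟦X⟧ →+ (ArithmeticFunction ℂ →+ ArithmeticFunction ℂ) :=
  AddMonoidHom.mk' (fun x => actHom (rhoMat (x.map (Int.castRingHom ℂ) • 1))) fun x y => by
    ext1 F
    rw [map_add, add_smul, map_add, actHom_add, AddMonoidHom.add_apply]

lemma scalarHom_apply (x : ℤ⟦X⟧) (F : ArithmeticFunction ℂ) :
    scalarHom x F = actHom (rhoMat (x.map (Int.castRingHom ℂ) • 1)) F := by
  rw [scalarHom, AddMonoidHom.mk'_apply]

lemma scalarHom_apply_eq_mul (x : ℤ⟦X⟧) (F : ArithmeticFunction ℂ) :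
    scalarHom x F = scalarHom x 1 * F := by
  refine powerSeries_apply_eq_mul scalarHom tauSeries_apply_one (fun F => ?_) (fun x F => ?_) x F
  · rw [scalarHom_apply, map_one, one_smul, map_one, actHom_one]
  · rw [scalarHom_apply, scalarHom_apply, ← actHom_X_smul_one, ← actHom_mul, ← map_mul, map_mul,
      map_X, smul_mul_smul_comm, one_mul, mul_comm]

lemma map_gSeries :
    (PowerSeries.mk fun n => if n = 0 then 0 else bSeq n).map (Int.castRingHom ℂ) = gSeries := by
  ext n
  rw [gSeries, coeff_map, coeff_mk, coeff_mk, eq_intCast, apply_ite Int.cast, Int.cast_zero]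

lemma rowSeries_gSeries_smul (v : Fin 2 → ℂ⟦X⟧) :
    rowSeries (gSeries • v) = rowSeries ![gSeries, 0] * rowSeries v := by
  have h (w : Fin 2 → ℂ⟦X⟧) : rowSeries (gSeries • w) =
      scalarHom (PowerSeries.mk fun n => if n = 0 then 0 else bSeq n) (rowSeries w) := by
    rw [scalarHom_apply, map_gSeries, ← rowSeries_vecMul, vecMul_smul, vecMul_one]
  have h1 : (![gSeries, 0] : Fin 2 → ℂ⟦X⟧) = gSeries • ![1, 0] := by
    rw [smul_cons, smul_cons, smul_eq_mul, smul_eq_mul, mul_one, mul_zero, smul_empty]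
  rw [h1, h, h ![1, 0], rowSeries_one, ← scalarHom_apply_eq_mul]

end RowSeries

section PhiSeries

open PowerSeries Matrix MatrixGroups
open scoped ArithmeticFunction.zeta ArithmeticFunction.Moebius

/-- The Dirichlet series `φ` as an arithmetic function. -/
def phiArith : ArithmeticFunction ℂ := toArith phiSeries

lemma phiArith_eq_rowSeries : phiArith = rowSeries ![0, 1] := by
  have hS : -ModularGroup.S = ModularGroup.S * ModularGroup.S * ModularGroup.S := by decide
  have hv : ((![1, 0] ᵥ* sMat) ᵥ* sMat) ᵥ* sMat = (![0, 1] : Fin 2 → ℂ⟦X⟧) := by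
    ext1 j
    fin_cases j <;> simp [sMat]
  rw [phiArith, phiSeries, ← actHom_toArith, toArith_oneSeries, hS, map_mul, map_mul,
    Units.val_mul, Units.val_mul, rho_S, actHom_mul, actHom_mul, ← rowSeries_one,
    ← rowSeries_vecMul, ← rowSeries_vecMul, ← rowSeries_vecMul, hv]

lemma actHom_sMat_rowSeries (a b : ℂ⟦X⟧) :
    actHom (rhoMat sMat) (rowSeries ![a, b]) = rowSeries ![b, -a] := by
  rw [← rowSeries_vecMul]
  congr 1
  ext1 j
  fin_cases j <;> simp [sMat]

lemma zeta_eq_rowSeries : (ζ : ArithmeticFunction ℂ) = rowSeries ![1, 1 + gSeries] := by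
  rw [← mul_one (ζ : ArithmeticFunction ℂ), ← actHom_jMat, ← rowSeries_one, ← rowSeries_vecMul]
  congr 1
  ext1 j
  fin_cases j <;> simp [jMat]

lemma zeta_mul_phiArith_eq_rowSeries :
    (ζ : ArithmeticFunction ℂ) * phiArith = rowSeries ![gSeries, 1 + X] := by
  rw [← actHom_jMat, phiArith_eq_rowSeries, ← rowSeries_vecMul]
  congr 1
  ext1 j
  fin_cases j <;> simp [jMat]

lemma rowSeries_zero_gSeries : rowSeries ![0, gSeries] = ζ - 1 - phiArith := by
  rw [zeta_eq_rowSeries, phiArith_eq_rowSeries, ← rowSeries_one, ← map_sub, ← map_sub]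
  congr 1
  ext1 j
  fin_cases j <;> simp

lemma rowSeries_gSeries_zero : rowSeries ![gSeries, 0] = phiArith - μ * phiArith := by
  have h : rowSeries ![gSeries, 0] = ζ * phiArith - phiArith - tauSeries * phiArith := by
    rw [zeta_mul_phiArith_eq_rowSeries, phiArith_eq_rowSeries, ← rowSeries_X_smul, ← map_sub,
      ← map_sub]
    congr 1
    ext1 j
    fin_cases j <;> simp
  rw [h, tauSeries]
  ring

lemma zeta_sub_one_sub_phiArith :
    (ζ : ArithmeticFunction ℂ) - 1 - phiArith = (phiArith - μ * phiArith) * phiArith := by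
  have h : (![0, gSeries] : Fin 2 → ℂ⟦X⟧) = gSeries • ![0, 1] := by
    rw [smul_cons, smul_cons, smul_eq_mul, smul_eq_mul, mul_one, mul_zero, smul_empty]
  rw [← rowSeries_zero_gSeries, h, rowSeries_gSeries_smul, rowSeries_gSeries_zero,
    ← phiArith_eq_rowSeries]

lemma phiArith_quadratic :
    phiArith = (ζ - 1) + (ζ - 1) * (ζ - 1) - (ζ - 1) * phiArith -
      (ζ - 1) * (phiArith * phiArith) := by
  linear_combination (-(ζ : ArithmeticFunction ℂ)) * zeta_sub_one_sub_phiArith +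
    (phiArith * phiArith) * ArithmeticFunction.coe_zeta_mul_coe_moebius (R := ℂ)

lemma actHom_sMat_one : actHom (rhoMat sMat) 1 = -phiArith := by
  rw [← rowSeries_one, actHom_sMat_rowSeries, phiArith_eq_rowSeries, ← map_neg, neg_cons,
    neg_cons, neg_zero, neg_empty]

lemma actHom_sMat_phiArith : actHom (rhoMat sMat) phiArith = 1 := by
  rw [phiArith_eq_rowSeries, actHom_sMat_rowSeries, neg_zero, rowSeries_one]

lemma actHom_sMat_zeta : actHom (rhoMat sMat) ζ = 1 - μ * phiArith := by
  have h : rowSeries ![1 + gSeries, -1] = 1 + rowSeries ![gSeries, 0] - phiArith := by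
    rw [phiArith_eq_rowSeries, ← rowSeries_one, ← map_add, ← map_sub]
    congr 1
    ext1 j
    fin_cases j <;> simp
  rw [zeta_eq_rowSeries, actHom_sMat_rowSeries, h, rowSeries_gSeries_zero]
  ring

lemma actHom_sMat_zeta_mul_phiArith :
    actHom (rhoMat sMat) (ζ * phiArith) = μ + phiArith := by
  have h : rowSeries ![1 + X, -gSeries] = 1 + tauSeries * 1 - rowSeries ![0, gSeries] := by
    rw [← rowSeries_one, ← rowSeries_X_smul, ← map_add, ← map_sub]
    congr 1
    ext1 j
    fin_cases j <;> simp
  rw [zeta_mul_phiArith_eq_rowSeries, actHom_sMat_rowSeries, h, rowSeries_zero_gSeries, tauSeries]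
  ring

/-- The additive group generated by the formal Dirichlet series `ζ ^ m` and `φ ζ ^ m`. -/
abbrev zetaPhiSpan : AddSubgroup (ArithmeticFunction ℂ) :=
  zpowSpan ArithmeticFunction.zetaUnit phiArith

lemma zeta_mul_mem_zetaPhiSpan {F : ArithmeticFunction ℂ} (hF : F ∈ zetaPhiSpan) :
    ζ * F ∈ zetaPhiSpan := by
  rw [← ArithmeticFunction.coe_zetaUnit]
  exact unit_mul_mem_zpowSpan hF

lemma moebius_mul_mem_zetaPhiSpan {F : ArithmeticFunction ℂ} (hF : F ∈ zetaPhiSpan) :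
    μ * F ∈ zetaPhiSpan := by
  rw [← ArithmeticFunction.inv_zetaUnit]
  exact inv_mul_mem_zpowSpan hF

lemma actHom_sMat_mem_zetaPhiSpan {F : ArithmeticFunction ℂ} (hF : F ∈ zetaPhiSpan) :
    actHom (rhoMat sMat) F ∈ zetaPhiSpan := by
  have h_moebius : (μ : ArithmeticFunction ℂ) ∈ zetaPhiSpan := by
    rw [← mul_one (μ : ArithmeticFunction ℂ)]
    exact moebius_mul_mem_zetaPhiSpan one_mem_zpowSpan
  refine map_mem_zpowSpan (fun G => ?_) ?_ ?_ ?_ ?_ hF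
  · rw [ArithmeticFunction.coe_zetaUnit, ArithmeticFunction.inv_zetaUnit]
    exact actHom_trace sMat G
  · rw [actHom_sMat_one]
    exact neg_mem right_mem_zpowSpan
  · rw [ArithmeticFunction.coe_zetaUnit, actHom_sMat_zeta]
    exact sub_mem one_mem_zpowSpan (moebius_mul_mem_zetaPhiSpan right_mem_zpowSpan)
  · rw [actHom_sMat_phiArith]
    exact one_mem_zpowSpan
  · rw [ArithmeticFunction.coe_zetaUnit, mul_comm, actHom_sMat_zeta_mul_phiArith]
    exact add_mem h_moebius right_mem_zpowSpan

lemma coe_rho_T_inv :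
    (↑(rho ModularGroup.T)⁻¹ : Module.End ℂ (Col ℕ+)) = rhoMat jMat.adjugate := by
  refine Units.inv_eq_of_mul_eq_one_right ?_
  rw [rho_T, ← map_mul, mul_adjugate, det_jMat, one_smul, map_one]

lemma actHom_rho_mem_zetaPhiSpan (Y : SL(2, ℤ)) {F : ArithmeticFunction ℂ}
    (hF : F ∈ zetaPhiSpan) : actHom (rho Y) F ∈ zetaPhiSpan := by
  have hY : Y ∈ Subgroup.closure {ModularGroup.S, ModularGroup.T} := by
    rw [SpecialLinearGroup.SL2Z_generators]
    trivial
  induction hY using Subgroup.closure_induction_right generalizing F with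
  | one => rwa [map_one, Units.val_one, actHom_one]
  | mul_right X _ Y hY ih =>
    rw [map_mul, Units.val_mul, actHom_mul]
    rcases hY with rfl | rfl
    · rw [rho_S]
      exact actHom_sMat_mem_zetaPhiSpan (ih hF)
    · rw [rho_T, actHom_jMat]
      exact zeta_mul_mem_zetaPhiSpan (ih hF)
  | mul_inv_cancel X _ Y hY ih =>
    rw [map_mul, Units.val_mul, actHom_mul]
    rcases hY with rfl | rfl
    · have h : ModularGroup.S⁻¹ = ModularGroup.S * ModularGroup.S * ModularGroup.S := by decide
      rw [h, map_mul, map_mul, Units.val_mul, Units.val_mul, actHom_mul, actHom_mul, rho_S]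
      exact actHom_sMat_mem_zetaPhiSpan (actHom_sMat_mem_zetaPhiSpan
        (actHom_sMat_mem_zetaPhiSpan (ih hF)))
    · rw [map_inv, coe_rho_T_inv, actHom_adjugate_jMat]
      exact moebius_mul_mem_zetaPhiSpan (ih hF)

lemma toArith_mem_zetaPhiSpan {f : ℕ+ → ℂ} (hf : f ∈ orbit oneSeries) :
    toArith f ∈ zetaPhiSpan := by
  obtain ⟨Y, rfl⟩ := hf
  rw [← actHom_toArith, toArith_oneSeries]
  exact actHom_rho_mem_zetaPhiSpan Y one_mem_zpowSpan

end PhiSeries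

section DirichletSeries

open Filter Topology
open scoped ArithmeticFunction.zeta ArithmeticFunction.Moebius

lemma sum_Ioc_zero_eq_sum_range {M : Type*} [AddCommMonoid M] (f : ℕ → M) (N : ℕ) :
    ∑ n ∈ Finset.Ioc 0 N, f n = ∑ n ∈ Finset.range N, f (n + 1) := by
  induction N with
  | zero => rfl
  | succ N ih => rw [Finset.sum_range_succ, ← ih, Finset.sum_Ioc_succ_top N.zero_le]

lemma tendsto_sum_Ioc_mul {R : Type*} [NormedRing R] [CompleteSpace R] {A B : ArithmeticFunction R}
    {L : R} (hA : Summable fun n => ‖A n‖)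
    (hB : Tendsto (fun N => ∑ n ∈ Finset.Ioc 0 N, B n) atTop (𝓝 L)) :
    Tendsto (fun N => ∑ n ∈ Finset.Ioc 0 N, (A * B) n) atTop (𝓝 ((∑' n, A n) * L)) := by
  obtain ⟨C, hC⟩ := (Metric.isBounded_range_of_tendsto _ hB).exists_norm_le
  have hB_le (N : ℕ) : ‖∑ n ∈ Finset.Ioc 0 N, B n‖ ≤ C := hC _ ⟨N, rfl⟩
  have hsum (N : ℕ) : ∑ n ∈ Finset.Ioc 0 N, (A * B) n =
      ∑' n, if n ∈ Finset.Ioc 0 N then A n * ∑ m ∈ Finset.Ioc 0 (N / n), B m else 0 := by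
    rw [ArithmeticFunction.sum_Ioc_mul_eq_sum_sum, tsum_eq_sum (s := Finset.Ioc 0 N)]
    · exact Finset.sum_congr rfl fun n hn => (if_pos hn).symm
    · exact fun n hn => if_neg hn
  simp only [hsum]
  rw [← hA.of_norm.tsum_mul_right]
  refine tendsto_tsum_of_dominated_convergence (bound := fun n => ‖A n‖ * C)
    (hA.mul_right C) (fun n => ?_) (Eventually.of_forall fun N n => ?_)
  · obtain rfl | hn := Nat.eq_zero_or_pos n
    · simp
    · refine ((hB.comp (Nat.tendsto_div_const_atTop hn.ne')).const_mul (A n)).congr' ?_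
      filter_upwards [eventually_ge_atTop n] with N hN
      exact (if_pos (Finset.mem_Ioc.2 ⟨hn, hN⟩)).symm
  · split_ifs
    · exact norm_mul_le_of_le le_rfl (hB_le _)
    · rw [norm_zero]
      exact mul_nonneg (norm_nonneg _) ((norm_nonneg _).trans (hB_le 0))

/-- The ring endomorphism sending `F` to the arithmetic function `n ↦ F n * n ^ (-s)`, whose
partial sums are those of the Dirichlet series of `F` at `s`. -/
def twist (s : ℂ) : ArithmeticFunction ℂ →+* ArithmeticFunction ℂ where
  toFun F := ⟨fun n => F n * (n : ℂ) ^ (-s), by rw [ArithmeticFunction.map_zero, zero_mul]⟩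
  map_one' := by
    ext n
    obtain rfl | hn := eq_or_ne n 1 <;> simp [*]
  map_mul' F G := by
    ext n
    simp only [ArithmeticFunction.coe_mk, ArithmeticFunction.mul_apply, Finset.sum_mul]
    refine Finset.sum_congr rfl fun p hp => ?_
    rw [ArithmeticFunction.coe_mk, ArithmeticFunction.coe_mk,
      ← (Nat.mem_divisorsAntidiagonal.1 hp).1, Nat.cast_mul, Complex.natCast_mul_natCast_cpow]
    ring
  map_zero' := by
    ext n
    exact zero_mul _
  map_add' F G := by
    ext n
    exact add_mul _ _ _

lemma twist_apply (s : ℂ) (F : ArithmeticFunction ℂ) (n : ℕ) :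
    twist s F n = F n * (n : ℂ) ^ (-s) := rfl

lemma LSeries_term_eq_twist (F : ArithmeticFunction ℂ) (s : ℂ) :
    LSeries.term (fun n => F n) s = fun n => twist s F n := by
  funext n
  obtain rfl | hn := eq_or_ne n 0
  · rw [LSeries.term_zero, ArithmeticFunction.map_zero]
  · rw [LSeries.term_of_ne_zero hn, twist_apply, Complex.cpow_neg, div_eq_mul_inv]

/-- The Dirichlet series of `F` converges, possibly only conditionally, to `l` at `s`. -/
def SumsTo (F : ArithmeticFunction ℂ) (s l : ℂ) : Prop :=
  Tendsto (fun N => ∑ n ∈ Finset.Ioc 0 N, twist s F n) atTop (𝓝 l)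

lemma sumsTo_toArith {f : ℕ+ → ℂ} {s l : ℂ} :
    SumsTo (toArith f) s l ↔ Tendsto (partialSum f s) atTop (𝓝 l) := by
  have h (N : ℕ) : partialSum f s N = ∑ n ∈ Finset.Ioc 0 N, twist s (toArith f) n := by
    rw [sum_Ioc_zero_eq_sum_range]
    refine Finset.sum_congr rfl fun n _ => ?_
    rw [twist_apply, ← n.succ_eq_add_one, ← n.succPNat_coe, toArith_apply]
  rw [SumsTo, funext h]

lemma sumsTo_zero (s : ℂ) : SumsTo 0 s 0 := by
  simp only [SumsTo, map_zero, ArithmeticFunction.zero_apply, Finset.sum_const_zero]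
  exact tendsto_const_nhds

lemma SumsTo.add {F G : ArithmeticFunction ℂ} {s l m : ℂ} (hF : SumsTo F s l)
    (hG : SumsTo G s m) : SumsTo (F + G) s (l + m) := by
  simp only [SumsTo, map_add, ArithmeticFunction.add_apply, Finset.sum_add_distrib]
  exact Tendsto.add hF hG

lemma SumsTo.neg {F : ArithmeticFunction ℂ} {s l : ℂ} (hF : SumsTo F s l) :
    SumsTo (-F) s (-l) := by
  simp only [SumsTo, map_neg, ArithmeticFunction.neg_apply, Finset.sum_neg_distrib]
  exact Tendsto.neg hF

lemma sumsTo_one (s : ℂ) : SumsTo 1 s 1 := by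
  refine tendsto_const_nhds.congr' ?_
  filter_upwards [eventually_ge_atTop 1] with N hN
  simp only [map_one, ArithmeticFunction.one_apply, Finset.sum_ite_eq']
  rw [if_pos (Finset.mem_Ioc.2 ⟨one_pos, hN⟩)]

lemma SumsTo.mul_of_lseriesSummable {F G : ArithmeticFunction ℂ} {s l : ℂ}
    (hF : LSeriesSummable (fun n => F n) s) (hG : SumsTo G s l) :
    SumsTo (F * G) s (LSeries (fun n => F n) s * l) := by
  rw [LSeriesSummable, LSeries_term_eq_twist] at hF
  rw [LSeries, LSeries_term_eq_twist, SumsTo, map_mul]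
  exact tendsto_sum_Ioc_mul hF.norm hG

lemma SumsTo.zeta_mul {G : ArithmeticFunction ℂ} {s l : ℂ} (hs : 1 < s.re) (hG : SumsTo G s l) :
    SumsTo (ζ * G) s (riemannZeta s * l) := by
  have h := SumsTo.mul_of_lseriesSummable (F := ζ)
    (by simpa using ArithmeticFunction.LSeriesSummable_zeta_iff.2 hs) hG
  rwa [← ArithmeticFunction.LSeries_zeta_eq_riemannZeta hs]

lemma SumsTo.moebius_mul {G : ArithmeticFunction ℂ} {s l : ℂ} (hs : 1 < s.re)
    (hG : SumsTo G s l) : SumsTo (μ * G) s ((riemannZeta s)⁻¹ * l) := by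
  have h := SumsTo.mul_of_lseriesSummable (F := μ)
    (by simpa using ArithmeticFunction.LSeriesSummable_moebius_iff.2 hs) hG
  have h_inv := ArithmeticFunction.LSeries_zeta_mul_Lseries_moebius hs
  rw [ArithmeticFunction.LSeries_zeta_eq_riemannZeta hs] at h_inv
  rwa [← eq_inv_of_mul_eq_one_right h_inv]

lemma SumsTo.zetaUnit_zpow_mul {G : ArithmeticFunction ℂ} {s l : ℂ} (hs : 1 < s.re)
    (hG : SumsTo G s l) (m : ℤ) :
    SumsTo (↑(ArithmeticFunction.zetaUnit (R := ℂ) ^ m) * G) s (riemannZeta s ^ m * l) := by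
  have h0 := riemannZeta_ne_zero_of_one_lt_re hs
  induction m using Int.induction_on with
  | zero => simpa only [zpow_zero, Units.val_one, one_mul] using hG
  | succ i ih =>
    rw [add_comm, zpow_one_add, zpow_one_add₀ h0, Units.val_mul, ArithmeticFunction.coe_zetaUnit,
      mul_assoc, mul_assoc]
    exact ih.zeta_mul hs
  | pred i ih =>
    rw [sub_eq_neg_add, zpow_add, zpow_add₀ h0, zpow_neg_one, zpow_neg_one, Units.val_mul,
      ArithmeticFunction.inv_zetaUnit, mul_assoc, mul_assoc]
    exact ih.moebius_mul hs

end DirichletSeries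

section AbsoluteConvergence

open scoped ArithmeticFunction.zeta

variable {R : Type*} [NormedRing R]

/-- The partial sums of `∑ ‖F n‖`. They are submultiplicative for Dirichlet convolution. -/
def normSum (F : ArithmeticFunction R) (N : ℕ) : ℝ := ∑ n ∈ Finset.Ioc 0 N, ‖F n‖

lemma normSum_nonneg (F : ArithmeticFunction R) (N : ℕ) : 0 ≤ normSum F N :=
  Finset.sum_nonneg fun _ _ => norm_nonneg _

lemma normSum_mono (F : ArithmeticFunction R) : Monotone (normSum F) := fun _ _ h =>
  Finset.sum_le_sum_of_subset_of_nonneg (Finset.Ioc_subset_Ioc_right h) fun _ _ _ => norm_nonneg _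

lemma normSum_add_le (F G : ArithmeticFunction R) (N : ℕ) :
    normSum (F + G) N ≤ normSum F N + normSum G N := by
  rw [normSum, normSum, normSum, ← Finset.sum_add_distrib]
  exact Finset.sum_le_sum fun n _ => norm_add_le _ _

lemma normSum_sub_le (F G : ArithmeticFunction R) (N : ℕ) :
    normSum (F - G) N ≤ normSum F N + normSum G N := by
  have h_neg : normSum (-G) N = normSum G N := by
    simp only [normSum, ArithmeticFunction.neg_apply, norm_neg]
  rw [sub_eq_add_neg, ← h_neg]
  exact normSum_add_le F (-G) N

lemma normSum_mul_le_sum (F G : ArithmeticFunction R) (N : ℕ) :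
    normSum (F * G) N ≤ ∑ n ∈ Finset.Ioc 0 N, ‖F n‖ * normSum G (N / n) := by
  let norms (H : ArithmeticFunction R) : ArithmeticFunction ℝ :=
    ⟨fun n => ‖H n‖, by rw [ArithmeticFunction.map_zero, norm_zero]⟩
  calc normSum (F * G) N ≤ ∑ n ∈ Finset.Ioc 0 N, (norms F * norms G) n := by
        refine Finset.sum_le_sum fun n _ => ?_
        rw [ArithmeticFunction.mul_apply, ArithmeticFunction.mul_apply]
        exact norm_sum_le_of_le _ fun p _ => norm_mul_le _ _
    _ = ∑ n ∈ Finset.Ioc 0 N, ‖F n‖ * normSum G (N / n) :=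
        ArithmeticFunction.sum_Ioc_mul_eq_sum_sum _ _ _

lemma normSum_mul_le (F G : ArithmeticFunction R) (N : ℕ) :
    normSum (F * G) N ≤ normSum F N * normSum G N := by
  refine (normSum_mul_le_sum F G N).trans ?_
  rw [normSum, Finset.sum_mul]
  exact Finset.sum_le_sum fun n _ =>
    mul_le_mul_of_nonneg_left (normSum_mono G (Nat.div_le_self N n)) (norm_nonneg _)

lemma normSum_mul_succ_le {F : ArithmeticFunction R} (hF : F 1 = 0) (G : ArithmeticFunction R)
    (N : ℕ) : normSum (F * G) (N + 1) ≤ normSum F (N + 1) * normSum G N := by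
  refine (normSum_mul_le_sum F G (N + 1)).trans ?_
  rw [normSum, Finset.sum_mul]
  refine Finset.sum_le_sum fun n hn => ?_
  obtain rfl | h1 := eq_or_ne n 1
  · rw [hF, norm_zero, zero_mul, zero_mul]
  · have hn2 : 1 < n := lt_of_le_of_ne (Finset.mem_Ioc.1 hn).1 h1.symm
    exact mul_le_mul_of_nonneg_left
      (normSum_mono G (Nat.le_of_lt_succ (Nat.div_lt_self N.succ_pos hn2))) (norm_nonneg _)

lemma normSum_le_one_of_quadratic {z F : ArithmeticFunction R} (hz1 : z 1 = 0)
    (hz : ∀ N, normSum z N ≤ 1 / 4) (hF : F = z + z * z - z * F - z * (F * F)) (N : ℕ) :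
    normSum F N ≤ 1 := by
  induction N with
  | zero => simp [normSum]
  | succ N ih =>
    have hF0 := normSum_nonneg F N
    have hz0 := normSum_nonneg z (N + 1)
    have h_sq : normSum (F * F) N ≤ 1 :=
      (normSum_mul_le F F N).trans (mul_le_one₀ ih hF0 ih)
    calc normSum F (N + 1)
        = normSum (z + z * z - z * F - z * (F * F)) (N + 1) := by rw [← hF]
      _ ≤ normSum z (N + 1) + normSum (z * z) (N + 1) + normSum (z * F) (N + 1) +
            normSum (z * (F * F)) (N + 1) := by
          linarith [normSum_sub_le (z + z * z - z * F) (z * (F * F)) (N + 1),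
            normSum_sub_le (z + z * z) (z * F) (N + 1), normSum_add_le z (z * z) (N + 1)]
      _ ≤ 1 / 4 + 1 / 4 * (1 / 4) + 1 / 4 * 1 + 1 / 4 * 1 := by
          gcongr
          · exact hz _
          · exact (normSum_mul_le z z _).trans (mul_le_mul (hz _) (hz _) hz0 (by norm_num))
          · exact (normSum_mul_succ_le hz1 F N).trans (mul_le_mul (hz _) ih hF0 (by norm_num))
          · exact (normSum_mul_succ_le hz1 (F * F) N).trans
              (mul_le_mul (hz _) h_sq (normSum_nonneg _ _) (by norm_num))
      _ ≤ 1 := by norm_num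

lemma zeta_sub_one_apply {n : ℕ} (hn : n ≠ 0) :
    ((ζ : ArithmeticFunction ℂ) - 1) n = if n = 1 then 0 else 1 := by
  rw [sub_eq_add_neg, ArithmeticFunction.add_apply, ArithmeticFunction.neg_apply]
  split_ifs with h <;> simp [h, hn]

lemma twist_zeta_sub_one_apply_one (s : ℂ) : twist s (ζ - 1) 1 = 0 := by
  rw [twist_apply, zeta_sub_one_apply one_ne_zero, if_pos rfl, zero_mul]

lemma norm_twist_zeta_sub_one_le {s : ℂ} (hs : 4 ≤ s.re) {n : ℕ} (hn : n ≠ 1) :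
    ‖twist s (ζ - 1) n‖ ≤ 1 / (n : ℝ) ^ 4 := by
  obtain rfl | hn0 := Nat.eq_zero_or_pos n
  · simp
  rw [twist_apply, zeta_sub_one_apply hn0.ne', if_neg hn, one_mul,
    Complex.norm_natCast_cpow_of_pos hn0, Complex.neg_re, Real.rpow_neg n.cast_nonneg, one_div,
    ← Real.rpow_natCast]
  gcongr
  · exact_mod_cast hn0
  · exact_mod_cast hs

lemma normSum_twist_zeta_sub_one_le {s : ℂ} (hs : 4 ≤ s.re) (N : ℕ) :
    normSum (twist s (ζ - 1)) N ≤ 1 / 4 := by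
  have h_one : ‖twist s (ζ - 1) 1‖ = 0 := by rw [twist_zeta_sub_one_apply_one, norm_zero]
  have h_le : normSum (twist s (ζ - 1)) N ≤ ∑ n ∈ (Finset.Ioc 0 N).erase 1, 1 / (n : ℝ) ^ 4 := by
    rw [normSum, ← Finset.sum_erase (f := fun n => ‖twist s (ζ - 1) n‖) _ h_one]
    exact Finset.sum_le_sum fun n hn => norm_twist_zeta_sub_one_le hs (Finset.ne_of_mem_erase hn)
  have h_zeta := sum_le_hasSum (insert 1 ((Finset.Ioc 0 N).erase 1))
    (fun n _ => by positivity) hasSum_zeta_four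
  rw [Finset.sum_insert (Finset.notMem_erase _ _), Nat.cast_one, one_pow, div_one] at h_zeta
  have h_pi : Real.pi ^ 4 ≤ 3.15 ^ 4 := by
    gcongr
    exact Real.pi_lt_d2.le
  norm_num at h_pi
  linarith

lemma normSum_twist_phiArith_le {s : ℂ} (hs : 4 ≤ s.re) (N : ℕ) :
    normSum (twist s phiArith) N ≤ 1 := by
  refine normSum_le_one_of_quadratic (twist_zeta_sub_one_apply_one s)
    (normSum_twist_zeta_sub_one_le hs) ?_ N
  simp only [← map_mul, ← map_add, ← map_sub]
  exact congrArg (twist s) phiArith_quadratic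

lemma exists_sumsTo_phiArith {s : ℂ} (hs : 4 ≤ s.re) : ∃ l, SumsTo phiArith s l := by
  have h_summable : Summable fun n : ℕ => twist s phiArith (n + 1) := by
    refine .of_norm (summable_of_sum_range_le (c := 1) (fun n => norm_nonneg _) fun N => ?_)
    rw [← sum_Ioc_zero_eq_sum_range fun n => ‖twist s phiArith n‖]
    exact normSum_twist_phiArith_le hs N
  refine ⟨∑' n : ℕ, twist s phiArith (n + 1), ?_⟩
  simp only [SumsTo, sum_Ioc_zero_eq_sum_range]
  exact h_summable.hasSum.tendsto_sum_nat

end AbsoluteConvergence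

section AbelSummation

open Filter Topology

lemma norm_cpow_neg_sub_le {w : ℂ} (hw : -1 ≤ w.re) {x : ℝ} (hx : 0 < x) :
    ‖((x + 1 : ℝ) : ℂ) ^ (-w) - (x : ℂ) ^ (-w)‖ ≤ ‖w‖ * x ^ (-w.re - 1) := by
  have h_deriv (t : ℝ) (ht : t ∈ Set.Icc x (x + 1)) :
      HasDerivWithinAt (fun t : ℝ => (t : ℂ) ^ (-w)) (-w * (t : ℂ) ^ (-w - 1))
        (Set.Icc x (x + 1)) t := by
    have h := ((hasDerivAt_id (t : ℂ)).cpow_const (c := -w)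
      (Or.inl (by simpa using hx.trans_le ht.1))).comp_ofReal
    simpa using h.hasDerivWithinAt
  have h_bound (t : ℝ) (ht : t ∈ Set.Icc x (x + 1)) :
      ‖-w * (t : ℂ) ^ (-w - 1)‖ ≤ ‖w‖ * x ^ (-w.re - 1) := by
    rw [norm_mul, norm_neg, Complex.norm_cpow_eq_rpow_re_of_pos (hx.trans_le ht.1),
      Complex.sub_re, Complex.neg_re, Complex.one_re]
    exact mul_le_mul_of_nonneg_left (Real.rpow_le_rpow_of_nonpos hx ht.1 (by linarith))
      (norm_nonneg w)
  simpa using (convex_Icc x (x + 1)).norm_image_sub_le_of_norm_hasDerivWithin_le h_deriv h_bound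
    (Set.left_mem_Icc.2 (by linarith)) (Set.right_mem_Icc.2 (by linarith))

/-- The terms of the series obtained from `∑ a n * (n + 1) ^ (-w)` by summation by parts, up to
sign. -/
def abelTerm (a : ℕ → ℂ) (n : ℕ) (w : ℂ) : ℂ :=
  (((n + 1 + 1 : ℕ) : ℂ) ^ (-w) - ((n + 1 : ℕ) : ℂ) ^ (-w)) * ∑ k ∈ Finset.range (n + 1), a k

variable {a : ℕ → ℂ} {C : ℝ}

lemma norm_abelTerm_le (ha : ∀ N, ‖∑ k ∈ Finset.range N, a k‖ ≤ C) {w : ℂ} (hw : -1 ≤ w.re)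
    (n : ℕ) : ‖abelTerm a n w‖ ≤ ‖w‖ * ((n + 1 : ℕ) : ℝ) ^ (-w.re - 1) * C := by
  have h := norm_cpow_neg_sub_le hw (x := ((n + 1 : ℕ) : ℝ)) (by positivity)
  rw [← Nat.cast_add_one, Complex.ofReal_natCast, Complex.ofReal_natCast] at h
  exact norm_mul_le_of_le h (ha _)

lemma norm_abelTerm_le_of_mem (ha : ∀ N, ‖∑ k ∈ Finset.range N, a k‖ ≤ C) {r M : ℝ} (hr : 0 < r)
    {w : ℂ} (hrw : r ≤ w.re) (hM : ‖w‖ ≤ M) (n : ℕ) :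
    ‖abelTerm a n w‖ ≤ M * ((n + 1 : ℕ) : ℝ) ^ (-r - 1) * C := by
  have hC : 0 ≤ C := (norm_nonneg _).trans (ha 0)
  have hM0 : 0 ≤ M := (norm_nonneg w).trans hM
  refine (norm_abelTerm_le ha (by linarith) n).trans ?_
  gcongr
  exact_mod_cast n.succ_pos

lemma summable_natCast_succ_rpow {r : ℝ} (hr : 0 < r) (M C : ℝ) :
    Summable fun n : ℕ => M * ((n + 1 : ℕ) : ℝ) ^ (-r - 1) * C := by
  refine (Summable.mul_left M ?_).mul_right C
  exact (summable_nat_add_iff 1).2 (Real.summable_nat_rpow.2 (by linarith))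

lemma summable_abelTerm (ha : ∀ N, ‖∑ k ∈ Finset.range N, a k‖ ≤ C) {w : ℂ} (hw : 0 < w.re) :
    Summable fun n => abelTerm a n w :=
  .of_norm_bounded (summable_natCast_succ_rpow hw ‖w‖ C)
    (norm_abelTerm_le ha (by linarith))

lemma tendsto_sum_range_mul_cpow (ha : ∀ N, ‖∑ k ∈ Finset.range N, a k‖ ≤ C) {w : ℂ}
    (hw : 0 < w.re) :
    Tendsto (fun N => ∑ n ∈ Finset.range N, ((n + 1 : ℕ) : ℂ) ^ (-w) * a n) atTop
      (𝓝 (-∑' n, abelTerm a n w)) := by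
  have h_parts (N : ℕ) : ∑ n ∈ Finset.range (N + 1), ((n + 1 : ℕ) : ℂ) ^ (-w) * a n =
      ((N + 1 : ℕ) : ℂ) ^ (-w) * ∑ n ∈ Finset.range (N + 1), a n -
        ∑ n ∈ Finset.range N, abelTerm a n w :=
    Finset.sum_range_by_parts (fun n : ℕ => ((n + 1 : ℕ) : ℂ) ^ (-w)) a (N + 1)
  have h_cpow : Tendsto (fun N : ℕ => ((N + 1 : ℕ) : ℂ) ^ (-w)) atTop (𝓝 0) := by
    rw [tendsto_zero_iff_norm_tendsto_zero]
    simp only [Complex.norm_natCast_cpow_of_pos (Nat.succ_pos _), Complex.neg_re]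
    exact ((tendsto_rpow_neg_atTop hw).comp tendsto_natCast_atTop_atTop).comp
      (tendsto_add_atTop_nat 1)
  rw [← tendsto_add_atTop_iff_nat 1, ← zero_sub (∑' n, abelTerm a n w)]
  refine Tendsto.congr (fun N => (h_parts N).symm)
    (Tendsto.sub ?_ (summable_abelTerm ha hw).hasSum.tendsto_sum_nat)
  exact h_cpow.zero_mul_isBoundedUnder_le
    (isBoundedUnder_of ⟨C, fun N => ha (N + 1)⟩)

lemma differentiable_abelTerm (a : ℕ → ℂ) (n : ℕ) : Differentiable ℂ (abelTerm a n) := by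
  have h_cpow (m : ℕ) : Differentiable ℂ fun w : ℂ => ((m + 1 : ℕ) : ℂ) ^ (-w) := fun w =>
    differentiableAt_id.neg.const_cpow (Or.inl (Nat.cast_ne_zero.2 m.succ_ne_zero))
  exact ((h_cpow (n + 1)).sub (h_cpow n)).mul_const _

lemma differentiableOn_tsum_abelTerm (ha : ∀ N, ‖∑ k ∈ Finset.range N, a k‖ ≤ C) :
    DifferentiableOn ℂ (fun w => ∑' n, abelTerm a n w) (halfPlane 0) := by
  intro w (hw : 0 < w.re)
  let U := halfPlane (w.re / 2) ∩ Metric.ball 0 (‖w‖ + 1)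
  have hU : IsOpen U := (isOpen_halfPlane _).inter Metric.isOpen_ball
  have hwU : w ∈ U := ⟨half_lt_self hw, mem_ball_zero_iff.2 (lt_add_one _)⟩
  refine ((Complex.differentiableOn_tsum_of_summable_norm
    (summable_natCast_succ_rpow (half_pos hw) (‖w‖ + 1) C)
    (fun n => (differentiable_abelTerm a n).differentiableOn) hU fun n v hv => ?_).differentiableAt
      (hU.mem_nhds hwU)).differentiableWithinAt
  exact norm_abelTerm_le_of_mem ha (half_pos hw) hv.1.le (mem_ball_zero_iff.1 hv.2).le n

lemma SumsTo.exists_norm_sum_range_le {F : ArithmeticFunction ℂ} {s l : ℂ} (hF : SumsTo F s l) :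
    ∃ C, ∀ N, ‖∑ n ∈ Finset.range N, twist s F (n + 1)‖ ≤ C := by
  obtain ⟨C, hC⟩ := (Metric.isBounded_range_of_tendsto _ hF).exists_norm_le
  refine ⟨C, fun N => ?_⟩
  rw [← sum_Ioc_zero_eq_sum_range fun n => twist s F n]
  exact hC _ ⟨N, rfl⟩

lemma SumsTo.eq_neg_tsum_abelTerm {F : ArithmeticFunction ℂ} {σ s l m : ℂ} (hσ : SumsTo F σ m)
    (hs : SumsTo F s l) (h : σ.re < s.re) :
    l = -∑' n, abelTerm (fun n => twist σ F (n + 1)) n (s - σ) := by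
  obtain ⟨C, hC⟩ := hσ.exists_norm_sum_range_le
  have h_twist (n : ℕ) :
      twist s F (n + 1) = ((n + 1 : ℕ) : ℂ) ^ (-(s - σ)) * twist σ F (n + 1) := by
    rw [twist_apply, twist_apply, mul_left_comm,
      ← Complex.cpow_add _ _ (Nat.cast_ne_zero.2 n.succ_ne_zero), neg_sub, sub_add_eq_add_sub,
      add_neg_cancel, zero_sub]
  have h_lim := tendsto_sum_range_mul_cpow hC (w := s - σ) (by rwa [Complex.sub_re, sub_pos])
  refine tendsto_nhds_unique hs (h_lim.congr fun N => ?_)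
  rw [sum_Ioc_zero_eq_sum_range]
  exact Finset.sum_congr rfl fun n _ => (h_twist n).symm

lemma analyticOnNhd_of_sumsTo {F : ArithmeticFunction ℂ} {h : ℂ → ℂ} {a : ℝ}
    (hF : ∀ s ∈ halfPlane a, SumsTo F s (h s)) : AnalyticOnNhd ℂ h (halfPlane a) := by
  intro s (hs : a < s.re)
  obtain ⟨σ, haσ, hσs⟩ := exists_between hs
  have hσ := hF σ haσ
  obtain ⟨C, hC⟩ := hσ.exists_norm_sum_range_le
  have h_diff : DifferentiableOn ℂ
      (fun s => -∑' n, abelTerm (fun n => twist σ F (n + 1)) n (s - σ)) (halfPlane σ) :=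
    ((differentiableOn_tsum_abelTerm hC).comp (differentiableOn_id.sub_const (σ : ℂ))
      fun s (hs : σ < s.re) => show 0 < (s - σ).re by simpa using hs).neg
  exact (h_diff.congr fun s (hs : σ < s.re) =>
    hσ.eq_neg_tsum_abelTerm (hF s (haσ.trans hs)) hs).analyticAt
      ((isOpen_halfPlane σ).mem_nhds hσs)

end AbelSummation

section MeromorphicSums

open Filter Topology

variable {a : ℝ} {f g : ℂ → ℂ}

lemma Mero.mk_congr (hf : MeromorphicOn f (halfPlane a)) (hg : MeromorphicOn g (halfPlane a))
    (h : Set.EqOn f g (halfPlane a)) : Mero.mk f hf = Mero.mk g hg :=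
  (Mero.mk_eq_mk_iff hf hg).2 (h.eventuallyEq_of_mem (self_mem_codiscreteWithin _))

lemma Mero.mk_mul (hf : MeromorphicOn f (halfPlane a)) (hg : MeromorphicOn g (halfPlane a)) :
    Mero.mk (f * g) (hf.mul hg) = Mero.mk f hf * Mero.mk g hg := rfl

lemma Mero.mk_mul_mk_inv (hf : MeromorphicOn f (halfPlane a)) (h0 : ∀ s ∈ halfPlane a, f s ≠ 0) :
    Mero.mk f hf * Mero.mk f⁻¹ hf.inv = 1 :=
  (Mero.mk_mul hf hf.inv).symm.trans
    (Mero.mk_congr _ (MeromorphicOn.const 1) fun s hs => mul_inv_cancel₀ (h0 s hs))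

lemma Mero.mk_ne_zero (hf : MeromorphicOn f (halfPlane a)) (h0 : ∀ s ∈ halfPlane a, f s ≠ 0) :
    Mero.mk f hf ≠ 0 :=
  left_ne_zero_of_mul_eq_one (Mero.mk_mul_mk_inv hf h0)

lemma Mero.mk_zpow (hf : MeromorphicOn f (halfPlane a)) (h0 : ∀ s ∈ halfPlane a, f s ≠ 0)
    (m : ℤ) : Mero.mk (f ^ m) (hf.zpow m) = Mero.mk f hf ^ m := by
  have h_ne := Mero.mk_ne_zero hf h0
  induction m using Int.induction_on with
  | zero =>
    rw [zpow_zero (Mero.mk f hf)]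
    exact Mero.mk_congr _ (MeromorphicOn.const 1) fun s _ => zpow_zero (f s)
  | succ i ih =>
    rw [zpow_add_one₀ h_ne, ← ih, ← Mero.mk_mul]
    exact Mero.mk_congr _ _ fun s hs => zpow_add_one₀ (h0 s hs) _
  | pred i ih =>
    rw [zpow_sub_one₀ h_ne, ← eq_inv_of_mul_eq_one_right (Mero.mk_mul_mk_inv hf h0), ← ih,
      ← Mero.mk_mul]
    exact Mero.mk_congr _ _ fun s hs => zpow_sub_one₀ (h0 s hs) _

lemma meromorphicOn_riemannZeta (ha : 1 ≤ a) : MeromorphicOn riemannZeta (halfPlane a) := by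
  refine (DifferentiableOn.analyticOnNhd (fun s hs => ?_) (isOpen_halfPlane a)).meromorphicOn
  refine (differentiableAt_riemannZeta ?_).differentiableWithinAt
  rintro rfl
  exact ha.not_gt hs

lemma mk_riemannZeta_ne_zero (ha : 1 ≤ a) :
    Mero.mk riemannZeta (meromorphicOn_riemannZeta ha) ≠ 0 :=
  Mero.mk_ne_zero _ fun _ hs => riemannZeta_ne_zero_of_one_lt_re (ha.trans_lt hs)

/-- The Dirichlet series of `F` converges for `Re s > a`, and its sum represents the element `x` of
the field of meromorphic functions there. -/
def HasMeroSum (F : ArithmeticFunction ℂ) (x : Mero a) : Prop :=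
  ∃ (f : ℂ → ℂ) (hf : MeromorphicOn f (halfPlane a)),
    (∀ s ∈ halfPlane a, SumsTo F s (f s)) ∧ Mero.mk f hf = x

variable {F G : ArithmeticFunction ℂ} {x y : Mero a}

lemma hasMeroSum_zero : HasMeroSum 0 (0 : Mero a) :=
  ⟨fun _ => 0, MeromorphicOn.const 0, fun s _ => sumsTo_zero s, rfl⟩

lemma hasMeroSum_one : HasMeroSum 1 (1 : Mero a) :=
  ⟨fun _ => 1, MeromorphicOn.const 1, fun s _ => sumsTo_one s, rfl⟩

lemma HasMeroSum.add (hF : HasMeroSum F x) (hG : HasMeroSum G y) : HasMeroSum (F + G) (x + y) := by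
  obtain ⟨f, hf, hfF, rfl⟩ := hF
  obtain ⟨g, hg, hgG, rfl⟩ := hG
  exact ⟨f + g, hf.add hg, fun s hs => (hfF s hs).add (hgG s hs), rfl⟩

lemma HasMeroSum.neg (hF : HasMeroSum F x) : HasMeroSum (-F) (-x) := by
  obtain ⟨f, hf, hfF, rfl⟩ := hF
  exact ⟨-f, hf.neg, fun s hs => (hfF s hs).neg, rfl⟩

lemma HasMeroSum.zetaUnit_zpow_mul (ha : 1 ≤ a) (hF : HasMeroSum F x) (m : ℤ) :
    HasMeroSum (↑(ArithmeticFunction.zetaUnit (R := ℂ) ^ m) * F)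
      (Mero.mk riemannZeta (meromorphicOn_riemannZeta ha) ^ m * x) := by
  obtain ⟨f, hf, hfF, rfl⟩ := hF
  refine ⟨riemannZeta ^ m * f, ((meromorphicOn_riemannZeta ha).zpow m).mul hf,
    fun s hs => (hfF s hs).zetaUnit_zpow_mul (ha.trans_lt hs) m, ?_⟩
  rw [Mero.mk_mul ((meromorphicOn_riemannZeta ha).zpow m) hf, Mero.mk_zpow]
  exact fun s hs => riemannZeta_ne_zero_of_one_lt_re (ha.trans_lt hs)

lemma HasMeroSum.exists_mem_zpowSpan (ha : 1 ≤ a) (hG : HasMeroSum G y)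
    (hF : F ∈ zpowSpan ArithmeticFunction.zetaUnit G) :
    ∃ x ∈ zpowSpan (Units.mk0 _ (mk_riemannZeta_ne_zero ha)) y, HasMeroSum F x := by
  induction hF using AddSubgroup.closure_induction with
  | mem F hF =>
    rcases hF with ⟨m, rfl⟩ | ⟨m, rfl⟩
    · refine ⟨_, zpow_mem_zpowSpan m, ?_⟩
      simpa only [mul_one, Units.val_zpow_eq_zpow_val, Units.val_mk0] using
        hasMeroSum_one.zetaUnit_zpow_mul ha m
    · refine ⟨_, mul_zpow_mem_zpowSpan m, ?_⟩
      simpa only [mul_comm, Units.val_zpow_eq_zpow_val, Units.val_mk0] using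
        hG.zetaUnit_zpow_mul ha m
  | zero => exact ⟨0, zero_mem _, hasMeroSum_zero⟩
  | add F F' _ _ hF hF' =>
    obtain ⟨x, hx, hFx⟩ := hF
    obtain ⟨x', hx', hFx'⟩ := hF'
    exact ⟨x + x', add_mem hx hx', hFx.add hFx'⟩
  | neg F _ hF =>
    obtain ⟨x, hx, hFx⟩ := hF
    exact ⟨-x, neg_mem hx, hFx.neg⟩

variable {f : ℕ+ → ℂ}

lemma SumsTo.seriesSum_eq {s l : ℂ} (h : SumsTo (toArith f) s l) : seriesSum f s = l :=
  (sumsTo_toArith.1 h).limUnder_eq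

lemma HasMeroSum.sumsTo_seriesSum (h : HasMeroSum (toArith f) x) {s : ℂ} (hs : s ∈ halfPlane a) :
    SumsTo (toArith f) s (seriesSum f s) := by
  obtain ⟨g, -, hg, -⟩ := h
  rw [(hg s hs).seriesSum_eq]
  exact hg s hs

lemma HasMeroSum.mk_seriesSum (h : HasMeroSum (toArith f) x)
    (hf : MeromorphicOn (seriesSum f) (halfPlane a)) : Mero.mk (seriesSum f) hf = x := by
  obtain ⟨g, hgm, hg, rfl⟩ := h
  exact Mero.mk_congr hf hgm fun s hs => (hg s hs).seriesSum_eq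

lemma ConvergesAt.sumsTo_seriesSum {s : ℂ} (h : ConvergesAt f s) :
    SumsTo (toArith f) s (seriesSum f s) :=
  sumsTo_toArith.2 (tendsto_nhds_limUnder h)

lemma SumsTo.convergesAt {s l : ℂ} (h : SumsTo (toArith f) s l) : ConvergesAt f s :=
  ⟨l, sumsTo_toArith.1 h⟩

lemma convergesAt_of_abscissa_lt {s : ℂ} (h : abscissa f < (s.re : EReal)) : ConvergesAt f s := by
  obtain ⟨_, ⟨σ, hσ, rfl⟩, hlt⟩ := sInf_lt_iff.1 h
  exact hσ s (EReal.coe_lt_coe_iff.1 hlt)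

lemma abscissa_phiSeries_lt_top : abscissa phiSeries < ⊤ := by
  have h_le : abscissa phiSeries ≤ (4 : ℝ) := sInf_le ⟨4, fun s hs => ?_, rfl⟩
  · exact h_le.trans_lt (EReal.coe_lt_top 4)
  obtain ⟨l, hl⟩ := exists_sumsTo_phiArith hs.le
  exact hl.convergesAt

lemma exists_coe_eq_max_one {b : EReal} (hb : b < ⊤) : ∃ a : ℝ, (a : EReal) = max 1 b :=
  ⟨(max 1 b).toReal, EReal.coe_toReal (max_lt (EReal.coe_lt_top 1) hb).ne
    (lt_max_of_lt_left (EReal.bot_lt_coe 1)).ne'⟩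

end MeromorphicSums

end DivisorSL2

end

open DivisorSL2 in
theorem mainTheorem6 :
    DivisorSL2.orbit DivisorSL2.zetaSeries = DivisorSL2.orbit DivisorSL2.oneSeries ∧
    DivisorSL2.orbit DivisorSL2.phiSeries = DivisorSL2.orbit DivisorSL2.oneSeries ∧
    ∃ a : ℝ, (a : EReal) = max 1 (DivisorSL2.abscissa DivisorSL2.phiSeries) ∧
      (∀ f ∈ DivisorSL2.orbit DivisorSL2.oneSeries, ∀ s ∈ DivisorSL2.halfPlane a,
        DivisorSL2.ConvergesAt f s) ∧
      (∀ f ∈ DivisorSL2.orbit DivisorSL2.oneSeries,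
        AnalyticOnNhd ℂ (DivisorSL2.seriesSum f) (DivisorSL2.halfPlane a)) ∧
      ∃ (hζ : MeromorphicOn riemannZeta (DivisorSL2.halfPlane a))
        (hφ : MeromorphicOn (DivisorSL2.seriesSum DivisorSL2.phiSeries) (DivisorSL2.halfPlane a)),
        ∀ f ∈ DivisorSL2.orbit DivisorSL2.oneSeries,
          ∃ hf : MeromorphicOn (DivisorSL2.seriesSum f) (DivisorSL2.halfPlane a),
            DivisorSL2.Mero.mk (DivisorSL2.seriesSum f) hf ∈
              IntermediateField.adjoin ℂ
                {DivisorSL2.Mero.mk riemannZeta hζ,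
                  DivisorSL2.Mero.mk (DivisorSL2.seriesSum DivisorSL2.phiSeries) hφ} ∧
            DivisorSL2.Mero.mk (DivisorSL2.seriesSum f) hf ∈
              AddSubgroup.closure
                ({F | ∃ m : ℤ, F = DivisorSL2.Mero.mk riemannZeta hζ ^ m} ∪
                  {F | ∃ m : ℤ,
                    F = DivisorSL2.Mero.mk (DivisorSL2.seriesSum DivisorSL2.phiSeries) hφ *
                      DivisorSL2.Mero.mk riemannZeta hζ ^ m}) := by
  refine ⟨zetaSeries_eq_act ▸ orbit_act _ _, orbit_act _ _, ?_⟩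
  obtain ⟨a, ha⟩ := exists_coe_eq_max_one abscissa_phiSeries_lt_top
  have ha_one : 1 ≤ a := EReal.coe_le_coe_iff.1 (ha ▸ le_max_left (1 : EReal) _)
  have ha_abscissa : abscissa phiSeries ≤ a := ha ▸ le_max_right _ _
  have h_phi (s : ℂ) (hs : s ∈ halfPlane a) : SumsTo phiArith s (seriesSum phiSeries s) :=
    (convergesAt_of_abscissa_lt (ha_abscissa.trans_lt (EReal.coe_lt_coe hs))).sumsTo_seriesSum
  have h_phi_mero : MeromorphicOn (seriesSum phiSeries) (halfPlane a) :=
    (analyticOnNhd_of_sumsTo h_phi).meromorphicOn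
  have h_orbit {f : ℕ+ → ℂ} (hf : f ∈ orbit oneSeries) :=
    HasMeroSum.exists_mem_zpowSpan ha_one ⟨_, h_phi_mero, h_phi, rfl⟩ (toArith_mem_zetaPhiSpan hf)
  have h_sum {f : ℕ+ → ℂ} (hf : f ∈ orbit oneSeries) (s : ℂ) (hs : s ∈ halfPlane a) :
      SumsTo (toArith f) s (seriesSum f s) := by
    obtain ⟨x, -, hx⟩ := h_orbit hf
    exact hx.sumsTo_seriesSum hs
  have h_analytic {f : ℕ+ → ℂ} (hf : f ∈ orbit oneSeries) :
      AnalyticOnNhd ℂ (seriesSum f) (halfPlane a) := analyticOnNhd_of_sumsTo (h_sum hf)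
  refine ⟨a, ha, fun f hf s hs => (h_sum hf s hs).convergesAt, fun f hf => h_analytic hf,
    meromorphicOn_riemannZeta ha_one, h_phi_mero, fun f hf => ⟨(h_analytic hf).meromorphicOn, ?_⟩⟩
  obtain ⟨x, hx, hfx⟩ := h_orbit hf
  rw [hfx.mk_seriesSum, ← zpowSpan_mk0 (mk_riemannZeta_ne_zero ha_one)]
  exact ⟨mem_adjoin_of_mem_zpowSpan_mk0 ℂ _ hx, hx⟩
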